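/- Let $k$ be a field of characteristic $p>0$, let $r\ge 0$, and let $R=k[t_1,\dots,t_r]/(t_1^p,\dots,t_r^p)$. Let $K$ be an algebraically closed extension field of $k$ whose transcendence degree over $k$ is at least $r-1$. Write $R_K=K\otimes_k R$, and for an $R$-module $M$ (possibly infinite dimensional) let $M^K=\operatorname{Hom}_k(K,M)$, regarded as an $R_K$-module via $((a\otimes x)f)(b)=x\,f(ab)$ for $a,b\in K$, $x\in R$. For a homomorphism of $K$-algebras $\alpha\colon K[t]/(t^p)\to R_K$, let $\alpha^*$ denote restriction of scalars along $\alpha$, and call $\alpha$ flat if $R_K$ is flat as a $K[t]/(t^p)$-module via $\alpha$. Then an $R$-module $M$ is projective if and only if for every flat homomorphism of $K$-algebras $\alpha\colon K[t]/(t^p)\to R_K$ the $K[t]/(t^p)$-module $\alpha^*(M^K)$ is projective. -/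

import Mathlib

open scoped TensorProduct

noncomputable section

/-- The truncated polynomial algebra `k[t_1, …, t_r] / (t_1 ^ p, …, t_r ^ p)`. -/
abbrev TruncPoly (k : Type*) [Field k] (p r : ℕ) : Type _ :=
  MvPolynomial (Fin r) k ⧸
    Ideal.span (Set.range fun i : Fin r => (MvPolynomial.X i : MvPolynomial (Fin r) k) ^ p)

/-- The one-variable truncated polynomial algebra `K[t] / (t ^ p)`. -/
abbrev TruncPolyOne (K : Type*) [Field K] (p : ℕ) : Type _ :=
  Polynomial K ⧸ Ideal.span {(Polynomial.X : Polynomial K) ^ p}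

/-- `M ^ K = Hom_k(K, M)`. It is given a name of its own so that it can carry the action of
`K ⊗[k] R` below. -/
def HomExt (k K M : Type*) [Field k] [Field K] [Algebra k K] [AddCommGroup M] [Module k M] :
    Type _ :=
  K →ₗ[k] M

namespace HomExt

section

variable (k K M : Type*) [Field k] [Field K] [Algebra k K] [AddCommGroup M] [Module k M]

instance : AddCommGroup (HomExt k K M) := inferInstanceAs (AddCommGroup (K →ₗ[k] M))

instance : Module k (HomExt k K M) := inferInstanceAs (Module k (K →ₗ[k] M))

instance : FunLike (HomExt k K M) K M := inferInstanceAs (FunLike (K →ₗ[k] M) K M)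

/-- The action of `K` on `Hom_k(K, M)` through the argument: `(a f)(b) = f (a b)`. -/
def scalarAction : K →ₐ[k] Module.End k (HomExt k K M) where
  toFun a :=
    { toFun := fun f => (LinearMap.comp (show K →ₗ[k] M from f) (LinearMap.mulLeft k a) : K →ₗ[k] M)
      map_add' := fun _ _ => LinearMap.add_comp _ _ _
      map_smul' := fun _ _ => LinearMap.smul_comp _ _ _ }
  map_one' := by
    ext f
    exact LinearMap.ext fun b => congrArg f (one_mul b)
  map_mul' a a' := by
    ext f
    exact LinearMap.ext fun b => congrArg f (by simp only [LinearMap.mulLeft_apply]; ring)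
  map_zero' := by
    ext f
    exact LinearMap.ext fun b =>
      (congrArg f (zero_mul b)).trans (LinearMap.map_zero (show K →ₗ[k] M from f))
  map_add' a a' := by
    ext f
    exact LinearMap.ext fun b =>
      (congrArg f (add_mul a a' b)).trans (LinearMap.map_add (show K →ₗ[k] M from f) _ _)
  commutes' c := by
    ext f
    exact LinearMap.ext fun b =>
      (congrArg f (Algebra.smul_def c b).symm).trans
        (LinearMap.map_smul (show K →ₗ[k] M from f) c b)

variable (R : Type*) [CommRing R] [Algebra k R] [Module R M] [IsScalarTower k R M]

/-- The action of `R` on `Hom_k(K, M)` through the values: `(x f)(b) = x (f b)`. -/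
def valueAction : R →ₐ[k] Module.End k (HomExt k K M) where
  toFun x :=
    { toFun := fun f =>
        (LinearMap.comp (Algebra.lsmul k k M x) (show K →ₗ[k] M from f) : K →ₗ[k] M)
      map_add' := fun _ _ => LinearMap.comp_add _ _ _
      map_smul' := fun _ _ => LinearMap.comp_smul _ _ _ }
  map_one' := by
    ext f
    exact LinearMap.ext fun b => one_smul R (f b)
  map_mul' x x' := by
    ext f
    exact LinearMap.ext fun b => mul_smul x x' (f b)
  map_zero' := by
    ext f
    exact LinearMap.ext fun b => zero_smul R (f b)
  map_add' x x' := by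
    ext f
    exact LinearMap.ext fun b => add_smul x x' (f b)
  commutes' c := by
    ext f
    exact LinearMap.ext fun b => algebraMap_smul R c (f b)

theorem commute_actions (a : K) (x : R) :
    Commute (scalarAction k K M a) (valueAction k K M R x) := by
  ext f
  exact LinearMap.ext fun _ => rfl

/-- The `R_K`-module structure on `M ^ K = Hom_k(K, M)`, where `R_K = K ⊗[k] R`:
`((a ⊗ x) f)(b) = x (f (a b))`. -/
instance moduleTensor : Module (K ⊗[k] R) (HomExt k K M) :=
  Module.compHom (HomExt k K M)
    (Algebra.TensorProduct.lift (scalarAction k K M) (valueAction k K M R)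
      (commute_actions k K M R)).toRingHom

end

theorem tmul_smul_apply {k K M R : Type*} [Field k] [Field K] [Algebra k K] [AddCommGroup M]
    [Module k M] [CommRing R] [Algebra k R] [Module R M] [IsScalarTower k R M]
    (a : K) (x : R) (f : HomExt k K M) (b : K) :
    ((a ⊗ₜ[k] x : K ⊗[k] R) • f) b = x • f (a * b) := by
  change (Algebra.TensorProduct.lift (scalarAction k K M) (valueAction k K M R)
    (commute_actions k K M R) (a ⊗ₜ[k] x) f) b = _
  rw [Algebra.TensorProduct.lift_tmul]
  rfl

end HomExt

/-- `α^* N`, the restriction of the `B`-module `N` along `α : A → B`, is a projective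
`A`-module. -/
def ProjectiveAlong {A B : Type*} [Semiring A] [Semiring B] (α : A →+* B)
    (N : Type*) [AddCommGroup N] [Module B N] : Prop :=
  letI : Module A N := Module.compHom N α
  Module.Projective A N

end

/-! A module over a truncated polynomial algebra is free exactly when every element killed by the
socle generator `∏ t_i ^ (p - 1)` lies in `∑ t_i M` (`IsTruncated.free_of_socleFree`). This
condition, `SocleFree`, makes sense for any finite family of commuting elements, and it passes from
`M` to `M ^ K` and back. Hence `M ^ K` is projective over `R_K` when `M` is projective over `R`, and
restriction along a flat `α` keeps it projective.

The converse needs only those `α` that send `t` to a nonzero linear form `∑ a_i t_i`; they are flat.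
The proof is by induction on the number of elements (`linearDetection`). Let `L` be the algebraic
closure in `K` of `k(t)` with `t` transcendental over `k`. For each nonzero `(l, m)` over `L`,
replace two of the elements `s_i, s_j` by `l s_i + m s_j`. Since `(M ^ L) ^ K = M ^ K` and only one
unit of transcendence degree was spent, induction applies to this shorter family on `M ^ L`. Passing
to the image `W` of `M` under the product of the powers `s_c ^ (p - 1)` of the remaining elements
leaves a problem about two elements `t₁, t₂` (`socleFree_of_pencil`).

In rank two, let `U` and `V` be the Tate cohomology of `W` in degrees `-1` and `1`; the aim is `U =
0`. Two maps `f, g : U → V` of degree two are given by multiplication by `t₂ ^ (p - 1)` and `t₁ ^ (p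
- 1)`. Freeness along all linear forms over `L` makes every nontrivial `L`-combination of `f` and
`g` bijective on `Hom_k(L, U)` (`RankTwo.bijective`). Then `U` becomes a divisible, hence injective,
`k[X]`-module on whose coextension each `X - l` is invertible. A nonzero element of `U` would yield
a nonzero `k[X]`-map `L → U`, with `X` acting on `L` as `t`, and this map is killed by `X - t`: a
contradiction (`subsingleton_of_bijective_pencil`). -/

/-! ### The socle condition for a family of elements. -/

/-- For commuting elements `s i` with `s i ^ p = 0`, the elements of `M` killed by
`∏ i ∈ J, s i ^ (p - 1)` are exactly those in `∑ i ∈ J, s i • M`. -/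
def SocleFree (p : ℕ) {ι S : Type*} [CommRing S] (s : ι → S) (J : Finset ι)
    (M : Type*) [AddCommGroup M] [Module S M] : Prop :=
  ∀ m : M, (∏ i ∈ J, s i ^ (p - 1)) • m = 0 → ∃ c : ι → M, m = ∑ i ∈ J, s i • c i

namespace SocleFree

variable {p : ℕ} {ι S : Type*} [CommRing S] {s s' : ι → S} {J J' : Finset ι}
  {M : Type*} [AddCommGroup M] [Module S M]

theorem congr (h : SocleFree p s J M) (hs : ∀ i ∈ J, s i = s' i) : SocleFree p s' J M := by
  intro m hm
  have hprod : ∏ i ∈ J, s i ^ (p - 1) = ∏ i ∈ J, s' i ^ (p - 1) :=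
    Finset.prod_congr rfl fun i hi => by rw [hs i hi]
  obtain ⟨c, hc⟩ := h m (hprod ▸ hm)
  exact ⟨c, hc.trans (Finset.sum_congr rfl fun i hi => by rw [hs i hi])⟩

theorem prod_smul_sum (hp : p ≠ 0) (hs : ∀ i ∈ J, s i ^ p = 0) (c : ι → M) :
    (∏ i ∈ J, s i ^ (p - 1)) • ∑ i ∈ J, s i • c i = 0 := by
  classical
  rw [Finset.smul_sum]
  refine Finset.sum_eq_zero fun i hi => ?_
  rw [smul_smul, ← Finset.prod_erase_mul J _ hi, mul_assoc, ← pow_succ,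
    Nat.sub_add_cancel (Nat.one_le_iff_ne_zero.2 hp), hs i hi, mul_zero, zero_smul]

/-- The part of `m` outside `∑ i ∈ J, s i • M` can be pushed into `s j ^ l • M` for growing `l`, and
it vanishes at `l = p`. -/
theorem of_insert [DecidableEq ι] (hp : p ≠ 0) {j : ι} (hj : j ∉ J)
    (hs : ∀ i ∈ insert j J, s i ^ p = 0)
    (h : SocleFree p s (insert j J) M) : SocleFree p s J M := by
  intro m hm
  have hsJ : ∀ i ∈ J, s i ^ p = 0 := fun i hi => hs i (Finset.mem_insert_of_mem hi)
  have key : ∀ l ≤ p, ∃ (c : ι → M) (n : M), m = ∑ i ∈ J, s i • c i + s j ^ l • n ∧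
      (s j ^ l * ∏ i ∈ J, s i ^ (p - 1)) • n = 0 := by
    intro l
    induction l with
    | zero => exact fun _ => ⟨0, m, by simp, by simpa using hm⟩
    | succ l ih =>
      intro hl
      obtain ⟨c, n, hmn, hn⟩ := ih (Nat.le_of_succ_le hl)
      -- Multiplying by `s j ^ (p - 1 - l)` completes the power of `s j`, so the hypothesis for
      -- `insert j J` applies to `n`.
      have hn' : (∏ i ∈ insert j J, s i ^ (p - 1)) • n = 0 := by
        rw [Finset.prod_insert hj, ← pow_sub_mul_pow (s j) (Nat.le_sub_one_of_lt hl),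
          mul_assoc, mul_smul, hn, smul_zero]
      obtain ⟨d, hd⟩ := h n hn'
      rw [Finset.sum_insert hj] at hd
      refine ⟨fun i => c i + s j ^ l • d i, d j, ?_, ?_⟩
      · rw [hmn]
        conv_lhs => rw [hd]
        simp only [smul_add, Finset.sum_add_distrib, Finset.smul_sum, smul_smul, pow_succ,
          mul_comm (s j ^ l)]
        abel
      · rw [hd, smul_add, mul_smul, mul_smul (s j ^ l), prod_smul_sum hp hsJ, smul_zero, add_zero,
          smul_smul, smul_smul] at hn
        rw [← hn]
        congr 1
        ring
  obtain ⟨c, n, hmn, -⟩ := key p le_rfl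
  exact ⟨c, by rw [hmn, hs j (Finset.mem_insert_self _ _), zero_smul, add_zero]⟩

theorem mono (hp : p ≠ 0) (hs : ∀ i ∈ J, s i ^ p = 0) (h : SocleFree p s J M) (hJ : J' ⊆ J) :
    SocleFree p s J' M := by
  classical
  induction hn : (J \ J').card generalizing J' with
  | zero =>
    rw [Finset.card_eq_zero, Finset.sdiff_eq_empty_iff_subset] at hn
    rwa [hJ.antisymm hn]
  | succ n ih =>
    obtain ⟨j, hj⟩ := Finset.card_pos.1 (n.succ_pos.trans_eq hn.symm)
    obtain ⟨hjJ, hjJ'⟩ := Finset.mem_sdiff.1 hj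
    have hsub : insert j J' ⊆ J := Finset.insert_subset hjJ hJ
    refine of_insert hp hjJ' (fun i hi => hs i (hsub hi)) (ih hsub ?_)
    have : J \ insert j J' = (J \ J').erase j := by ext; simp; tauto
    rw [this, Finset.card_erase_of_mem hj, hn, Nat.add_sub_cancel]

/-- Replacing one of the elements by a linear combination of all of them in which its own
coefficient is invertible. -/
theorem change [DecidableEq ι] (hp : p ≠ 0) (hs : ∀ i ∈ J, s i ^ p = 0) (h : SocleFree p s J M)
    {j : ι} (hj : j ∈ J) (a : ι → S) (haj : IsUnit (a j)) :
    SocleFree p (Function.update s j (∑ i ∈ J, a i * s i)) J M := by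
  set x := ∑ i ∈ J, a i * s i with hx
  have hxj : x = a j * s j + ∑ i ∈ J.erase j, a i * s i := by
    rw [hx, ← Finset.add_sum_erase J _ hj]
  have hupd : ∀ i ∈ J.erase j, Function.update s j x i = s i := fun i hi =>
    Function.update_of_ne (Finset.ne_of_mem_erase hi) _ _
  have hkill : (∑ i ∈ J.erase j, a i * s i) * ∏ i ∈ J.erase j, s i ^ (p - 1) = 0 := by
    have := prod_smul_sum (M := S) (J := J.erase j) hp
      (fun i hi => hs i (Finset.mem_of_mem_erase hi)) a
    simpa only [smul_eq_mul, mul_comm] using this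
  -- Against the product over the other indices, `x` acts as `a j * s j`; so the socle element
  -- changes only by the unit `a j ^ (p - 1)`.
  have hpow : ∀ n : ℕ, x ^ n * ∏ i ∈ J.erase j, s i ^ (p - 1) =
      (a j * s j) ^ n * ∏ i ∈ J.erase j, s i ^ (p - 1) := by
    intro n
    induction n with
    | zero => simp
    | succ n ih =>
      rw [pow_succ', mul_assoc, ih, hxj, add_mul, mul_left_comm (∑ i ∈ J.erase j, a i * s i),
        hkill, mul_zero, add_zero, pow_succ', mul_assoc (a j * s j)]
  intro m hm
  rw [← Finset.mul_prod_erase J _ hj, Function.update_self,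
    Finset.prod_congr rfl fun i hi => by rw [hupd i hi], hpow, mul_pow, mul_assoc,
    Finset.mul_prod_erase J (fun i => s i ^ (p - 1)) hj, mul_smul,
    (haj.pow _).smul_eq_zero] at hm
  obtain ⟨c, hc⟩ := h m hm
  obtain ⟨u, hu⟩ := haj
  -- The witness comes from substituting `s j = u⁻¹ (x - ∑_{i ≠ j} a i s i)`.
  refine ⟨Function.update (fun i => c i - (a i * ↑u⁻¹) • c j) j ((↑u⁻¹ : S) • c j), ?_⟩
  rw [← Finset.add_sum_erase J _ hj, Function.update_self, Function.update_self,
    Finset.sum_congr rfl fun i hi => by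
      rw [hupd i hi, Function.update_of_ne (Finset.ne_of_mem_erase hi)], hxj, hc,
    ← Finset.add_sum_erase J _ hj]
  have h1 : a j * s j * (↑u⁻¹ : S) = s j := by
    rw [← hu, mul_right_comm, Units.mul_inv, one_mul]
  have h2 : ∀ i, s i * (a i * (↑u⁻¹ : S)) = a i * s i * ↑u⁻¹ := fun i => by ring
  simp only [smul_sub, Finset.sum_sub_distrib, smul_smul, add_smul, add_mul, h1, h2,
    ← Finset.sum_smul, ← Finset.sum_mul]
  abel

/-- `M` is a direct summand of a free module, where the condition is checked coordinate by
coordinate. -/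
theorem of_projective (h : SocleFree p s J S) [Module.Projective S M] : SocleFree p s J M := by
  classical
  intro m hm
  obtain ⟨σ, hσ⟩ := (Module.projective_def' (R := S) (P := M)).1 inferInstance
  have hm' : ∀ v, ∃ c : ι → S, σ m v = ∑ i ∈ J, s i • c i := fun v => by
    refine h _ ?_
    rw [← Finsupp.smul_apply, ← map_smul, hm, map_zero, Finsupp.zero_apply]
  choose c hc using hm'
  refine ⟨fun i => Finsupp.linearCombination S id
    (∑ v ∈ (σ m).support, Finsupp.single v (c v i)), ?_⟩
  have hσm : σ m = ∑ i ∈ J, s i • ∑ v ∈ (σ m).support, Finsupp.single v (c v i) := by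
    simp only [Finset.smul_sum, Finsupp.smul_single]
    rw [Finset.sum_comm]
    conv_lhs => rw [← Finsupp.sum_single (σ m), Finsupp.sum]
    exact Finset.sum_congr rfl fun v _ => by rw [hc v, Finsupp.single_finsetSum]
  conv_lhs => rw [← LinearMap.id_apply (R := S) m, ← hσ, LinearMap.comp_apply, hσm]
  simp only [map_sum, map_smul]

end SocleFree

theorem socleFree_singleton_iff {p : ℕ} {ι S : Type*} [CommRing S] {s : ι → S} {j : ι}
    {M : Type*} [AddCommGroup M] [Module S M] :
    SocleFree p s {j} M ↔ ∀ m : M, s j ^ (p - 1) • m = 0 → ∃ n : M, m = s j • n := by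
  simp only [SocleFree, Finset.prod_singleton, Finset.sum_singleton]
  exact forall₂_congr fun m _ => ⟨fun ⟨c, h⟩ => ⟨c j, h⟩, fun ⟨n, h⟩ => ⟨fun _ => n, h⟩⟩


/-! ### Rank two: cocycle computations along one linear form. -/

/-- In characteristic `p`, with `D = ∑ i < p - 1, A ^ i * (-B) ^ (p - 2 - i)`. -/
theorem exists_add_pow_sub_one (p : ℕ) [Fact p.Prime] (L : Type*) [Field L] [CharP L p]
    {Q : Type*} [CommRing Q] [Algebra L Q] (A B : Q) :
    ∃ D : Q, (A + B) ^ (p - 1) = A ^ (p - 1) - B * D ∧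
      (A + B) ^ (p - 1) = B ^ (p - 1) + A * D := by
  have hp1 : p - 1 + 1 = p := Nat.sub_add_cancel (Fact.out : p.Prime).one_le
  -- In the polynomial ring `a + b` can be cancelled, so both identities follow from `(a + b) ^ p =
  -- a ^ p + b ^ p` and `(a + b) D = a ^ (p - 1) - b ^ (p - 1)`.
  have key : ∃ D : MvPolynomial (Fin 2) L, (.X 0 + .X 1) ^ (p - 1) = .X 0 ^ (p - 1) - .X 1 * D ∧
      (.X 0 + .X 1) ^ (p - 1) = .X 1 ^ (p - 1) + .X 0 * D := by
    set a : MvPolynomial (Fin 2) L := .X 0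
    set b : MvPolynomial (Fin 2) L := .X 1 with hb
    have hb0 : b ≠ 0 := MvPolynomial.X_ne_zero 1
    have hab : a + b ≠ 0 := fun h => by
      have h1 := congrArg (MvPolynomial.eval ![1, 0]) h
      simp [a, b] at h1
    have hneg : (-b) ^ p = - b ^ p := by
      have := add_pow_char b (-b) p
      rw [add_neg_cancel, zero_pow (Fact.out : p.Prime).ne_zero] at this
      exact (neg_eq_of_add_eq_zero_right this.symm).symm
    have hneg1 : (-b) ^ (p - 1) = b ^ (p - 1) := by
      apply mul_right_cancel₀ (neg_ne_zero.2 hb0)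
      rw [← pow_succ, hp1, hneg, mul_neg, ← pow_succ, hp1]
    have hg := (Commute.all a (-b)).mul_geom_sum₂ (p - 1)
    rw [sub_neg_eq_add, hneg1] at hg
    refine ⟨∑ i ∈ Finset.range (p - 1), a ^ i * (-b) ^ (p - 1 - 1 - i), ?_, ?_⟩
    · apply mul_left_cancel₀ hab
      rw [← pow_succ', hp1, mul_sub, mul_left_comm, hg, add_pow_char]
      conv_lhs => rw [← hp1, pow_succ, pow_succ]
      ring
    · apply mul_left_cancel₀ hab
      rw [← pow_succ', hp1, mul_add, mul_left_comm, hg, add_pow_char]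
      conv_lhs => rw [← hp1, pow_succ, pow_succ]
      ring
  obtain ⟨D, h1, h2⟩ := key
  refine ⟨MvPolynomial.aeval ![A, B] D, ?_, ?_⟩
  · simpa using congrArg (MvPolynomial.aeval ![A, B]) h1
  · simpa using congrArg (MvPolynomial.aeval ![A, B]) h2

section RankTwo

variable {p : ℕ} {Q : Type*} [CommRing Q] {H : Type*} [AddCommGroup H] [Module Q H]

/-- With `x = l t₁ + m t₂`, this says that the pairs `(-m ^ p t₂ ^ (p - 1) h, l ^ p t₁ ^ (p - 1) h)`
and `(-m x ^ (p - 1) h, l x ^ (p - 1) h)` differ by the coboundary of `P h`. The `p`-th powers of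
the coefficients enter here. -/
theorem exists_linear_pow_sub_one [Fact p.Prime]
    (L : Type*) [Field L] [CharP L p] [Algebra L Q]
    (t₁ t₂ l m : Q) : ∃ P : Q,
    m * (l * t₁ + m * t₂) ^ (p - 1) = m ^ p * t₂ ^ (p - 1) - t₁ * P ∧
    l * (l * t₁ + m * t₂) ^ (p - 1) = l ^ p * t₁ ^ (p - 1) + t₂ * P := by
  obtain ⟨D, h1, h2⟩ := exists_add_pow_sub_one p L (l * t₁) (m * t₂)
  have hp1 : p - 1 + 1 = p := Nat.sub_add_cancel (Fact.out : p.Prime).one_le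
  have hl : l ^ p = l * l ^ (p - 1) := by rw [← pow_succ', hp1]
  have hm : m ^ p = m * m ^ (p - 1) := by rw [← pow_succ', hp1]
  refine ⟨-(l * m * D), ?_, ?_⟩
  · rw [h2, hm, mul_pow]; ring
  · rw [h1, hl, mul_pow]; ring

theorem eq_pow_smul_of_smul_eq_zero {x : Q} (hx : ∀ h : H, x ^ (p - 1) • h = 0 → ∃ g, h = x • g)
    {h : H} (hh : x • h = 0) : ∃ g, h = x ^ (p - 1) • g := by
  have key : ∀ n ≤ p - 1, ∃ g, h = x ^ n • g := by
    intro n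
    induction n with
    | zero => exact fun _ => ⟨h, by simp⟩
    | succ n ih =>
      intro hn
      obtain ⟨g, hg⟩ := ih (Nat.le_of_succ_le hn)
      obtain ⟨g', rfl⟩ := hx g (by
        rw [← pow_sub_mul_pow x hn, mul_smul, pow_succ', mul_smul, ← hg, hh, smul_zero])
      exact ⟨g', by rw [hg, smul_smul, pow_succ]⟩
  exact key _ le_rfl

/-- Injectivity of the combination of `f` and `g` attached to `x = l t₁ + m t₂`. The determinant
condition makes `x` and `y = l' t₁ + m' t₂` a new pair of coordinates, and the proof ends with `h =
y g + x u`. -/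
theorem rankTwo_injective [Fact p.Prime]
    (L : Type*) [Field L] [CharP L p] [Algebra L Q]
    {t₁ t₂ l m l' m' : Q} (hdet : l * m' - m * l' = 1)
    (hx : ∀ h : H, (l * t₁ + m * t₂) ^ (p - 1) • h = 0 → ∃ g, h = (l * t₁ + m * t₂) • g)
    {h G : H} (h1 : t₁ • G = -(m ^ p * t₂ ^ (p - 1)) • h)
    (h2 : t₂ • G = (l ^ p * t₁ ^ (p - 1)) • h) : ∃ u v, h = t₁ • u + t₂ • v := by
  obtain ⟨P, hP1, hP2⟩ := exists_linear_pow_sub_one (p := p) L t₁ t₂ l m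
  set x := l * t₁ + m * t₂ with hxdef
  -- Correcting `G` by `P • h` expresses the cocycle through `x`, so that `x` kills the corrected
  -- element.
  have k1 : t₁ • (G + P • h) = -(m * x ^ (p - 1)) • h := by
    rw [hP1, smul_add, h1]; module
  have k2 : t₂ • (G + P • h) = (l * x ^ (p - 1)) • h := by
    rw [hP2, smul_add, h2]; module
  have k3 : x • (G + P • h) = 0 := by
    rw [hxdef, add_smul, mul_smul, mul_smul, k1, k2]; module
  obtain ⟨g, hg⟩ := eq_pow_smul_of_smul_eq_zero hx k3
  have k4 : x ^ (p - 1) • (h - (l' * t₁ + m' * t₂) • g) = 0 := by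
    have : (l' * t₁ + m' * t₂) • (G + P • h) = x ^ (p - 1) • h := by
      have e : l' • -(m * x ^ (p - 1)) • h + m' • (l * x ^ (p - 1)) • h =
          (l * m' - m * l') • x ^ (p - 1) • h := by module
      rw [add_smul, mul_smul, mul_smul, k1, k2, e, hdet, one_smul]
    rw [smul_sub, ← this, hg]; module
  obtain ⟨u, hu⟩ := hx _ k4
  refine ⟨l' • g + l • u, m' • g + m • u, ?_⟩
  rw [sub_eq_iff_eq_add.1 hu, hxdef]; module

/-- Surjectivity of the same combination: subtracting the coboundary of `g` gives a cocycle `(a',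
b')` with `l a' + m b' = 0`. Such a cocycle is `(-m c, l c)` with `c = l' a' + m' b'`, and `x c = 0`
yields `c = x ^ (p - 1) h`. -/
theorem rankTwo_surjective [Fact p.Prime]
    (L : Type*) [Field L] [CharP L p] [Algebra L Q]
    {t₁ t₂ l m l' m' : Q} (ht₁ : t₁ ^ p = 0) (ht₂ : t₂ ^ p = 0)
    (hdet : l * m' - m * l' = 1)
    (hx : ∀ h : H, (l * t₁ + m * t₂) ^ (p - 1) • h = 0 → ∃ g, h = (l * t₁ + m * t₂) • g)
    {a b : H} (hab : t₁ • b = t₂ • a) (ha : t₁ ^ (p - 1) • a = 0) (hb : t₂ ^ (p - 1) • b = 0) :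
    ∃ h G : H, (t₁ ^ (p - 1) * t₂ ^ (p - 1)) • h = 0 ∧
      a = -(m ^ p * t₂ ^ (p - 1)) • h + t₁ • G ∧ b = (l ^ p * t₁ ^ (p - 1)) • h + t₂ • G := by
  obtain ⟨P, hP1, hP2⟩ := exists_linear_pow_sub_one (p := p) L t₁ t₂ l m
  have hp1 : p - 1 + 1 = p := Nat.sub_add_cancel (Fact.out : p.Prime).one_le
  set x := l * t₁ + m * t₂ with hxdef
  obtain ⟨g, hg⟩ := hx (l • a + m • b) (by
    have e1 : x ^ (p - 1) • (l • a + m • b) =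
        (l * x ^ (p - 1)) • a + (m * x ^ (p - 1)) • b := by module
    have e2 : ((l ^ p * t₁ ^ (p - 1) + t₂ * P) • a + (m ^ p * t₂ ^ (p - 1) - t₁ * P) • b) =
        l ^ p • t₁ ^ (p - 1) • a + m ^ p • t₂ ^ (p - 1) • b + P • (t₂ • a - t₁ • b) := by module
    rw [e1, hP1, hP2, e2, ha, hb, hab]; simp)
  obtain ⟨h, hh⟩ := eq_pow_smul_of_smul_eq_zero hx
    (h := l' • (a - t₁ • g) + m' • (b - t₂ • g)) (by
      have e1 : x • (l' • (a - t₁ • g) + m' • (b - t₂ • g)) =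
        (l' * t₁ + m' * t₂) • ((l • a + m • b) - x • g) + (l * m' - m * l') • (t₁ • b - t₂ • a) := by
        rw [hxdef]; module
      rw [e1, hg, hab]; simp)
  have hlin : l • (a - t₁ • g) + m • (b - t₂ • g) = 0 := by
    rw [← sub_eq_zero.2 hg, hxdef]; module
  have ea : a = -(m ^ p * t₂ ^ (p - 1)) • h + t₁ • (g + P • h) := by
    have : a - t₁ • g = -(m * x ^ (p - 1)) • h := by
      have e : a - t₁ • g = (l * m' - m * l') • (a - t₁ • g) := by rw [hdet, one_smul]
      have e' : (l * m' - m * l') • (a - t₁ • g) = m' • (l • (a - t₁ • g) + m • (b - t₂ • g)) -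
        m • (l' • (a - t₁ • g) + m' • (b - t₂ • g)) := by module
      rw [e, e', hlin, hh]; module
    rw [sub_eq_iff_eq_add.1 this, hP1]; module
  have eb : b = (l ^ p * t₁ ^ (p - 1)) • h + t₂ • (g + P • h) := by
    have : b - t₂ • g = (l * x ^ (p - 1)) • h := by
      have e : b - t₂ • g = (l * m' - m * l') • (b - t₂ • g) := by rw [hdet, one_smul]
      have e' : (l * m' - m * l') • (b - t₂ • g) = -l' • (l • (a - t₁ • g) + m • (b - t₂ • g)) +
        l • (l' • (a - t₁ • g) + m' • (b - t₂ • g)) := by module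
      rw [e, e', hlin, hh]; module
    rw [sub_eq_iff_eq_add.1 this, hP2]; module
  refine ⟨h, g + P • h, ?_, ea, eb⟩
  have z1 : m ^ p • (t₁ ^ (p - 1) * t₂ ^ (p - 1)) • h = 0 := by
    have := ha
    rw [ea, smul_add, smul_smul (t₁ ^ (p - 1)) t₁, ← pow_succ, hp1, ht₁, zero_smul, add_zero] at this
    rw [← neg_eq_zero, ← this]; module
  have z2 : l ^ p • (t₁ ^ (p - 1) * t₂ ^ (p - 1)) • h = 0 := by
    have := hb
    rw [eb, smul_add, smul_smul (t₂ ^ (p - 1)) t₂, ← pow_succ, hp1, ht₂, zero_smul, add_zero] at this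
    rw [← this]; module
  -- The cocycle conditions kill the socle multiple of `h` only after multiplication by `l ^ p` or
  -- by `m ^ p`; coprimality removes these factors.
  have hcop : IsCoprime (l ^ p) (m ^ p) := IsCoprime.pow ⟨m', -l', by linear_combination hdet⟩
  obtain ⟨u, v, huv⟩ := hcop
  have e : (t₁ ^ (p - 1) * t₂ ^ (p - 1)) • h = (u * l ^ p + v * m ^ p) •
      (t₁ ^ (p - 1) * t₂ ^ (p - 1)) • h := by rw [huv, one_smul]
  rw [e, add_smul, mul_smul u, mul_smul v, z1, z2, smul_zero, smul_zero, add_zero]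

end RankTwo


/-! ### Coextension of scalars and linear lifting. -/

namespace HomExt

section

variable {k K M N S : Type*} [Field k] [Field K] [Algebra k K] [AddCommGroup M] [Module k M]
  [AddCommGroup N] [Module k N] [CommRing S] [Algebra k S]
  [Module S M] [IsScalarTower k S M] [Module S N] [IsScalarTower k S N]

/-- A linear map, viewed as an element of `M ^ K`. -/
def ofLin (f : K →ₗ[k] M) : HomExt k K M := f

/-- The linear map underlying an element of `M ^ K`. -/
def toLin (f : HomExt k K M) : K →ₗ[k] M := f

@[simp] theorem ofLin_apply (f : K →ₗ[k] M) (b : K) : ofLin f b = f b := rfl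

@[simp] theorem toLin_apply (f : HomExt k K M) (b : K) : f.toLin b = f b := rfl

theorem ext {f g : HomExt k K M} (h : ∀ b, f b = g b) : f = g := LinearMap.ext (f := f.toLin) h

@[simp] theorem zero_apply (b : K) : (0 : HomExt k K M) b = 0 := rfl

@[simp] theorem add_apply (f g : HomExt k K M) (b : K) : (f + g) b = f b + g b := rfl

@[simp] theorem sub_apply (f g : HomExt k K M) (b : K) : (f - g) b = f b - g b := rfl

theorem sum_apply {ι : Type*} (J : Finset ι) (f : ι → HomExt k K M) (b : K) :
    (∑ i ∈ J, f i) b = ∑ i ∈ J, f i b :=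
  LinearMap.sum_apply J (fun i => (f i).toLin) b

theorem map_add (f : HomExt k K M) (a b : K) : f (a + b) = f a + f b := f.toLin.map_add a b

@[simp] theorem one_tmul_smul_apply (x : S) (f : HomExt k K M) (b : K) :
    ((1 ⊗ₜ[k] x : K ⊗[k] S) • f) b = x • f b := by
  rw [tmul_smul_apply, one_mul]

@[simp] theorem tmul_one_smul_apply (a : K) (f : HomExt k K M) (b : K) :
    ((a ⊗ₜ[k] 1 : K ⊗[k] S) • f) b = f (a * b) := by
  rw [tmul_smul_apply, one_smul]

/-- Composition with an `S`-linear map `M → N`, as a map `M ^ K → N ^ K`. -/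
def map (K : Type*) [Field K] [Algebra k K] (φ : M →ₗ[S] N) :
    HomExt k K M →ₗ[K ⊗[k] S] HomExt k K N where
  toFun f := ofLin (φ.restrictScalars k ∘ₗ f.toLin)
  map_add' f g := ext fun b => _root_.map_add φ (f b) (g b)
  map_smul' z f := by
    induction z with
    | zero =>
      rw [RingHom.id_apply, zero_smul, zero_smul]
      exact ext fun b => map_zero φ
    | add y z hy hz =>
      rw [RingHom.id_apply, add_smul, add_smul]
      rw [RingHom.id_apply] at hy hz
      rw [← hy, ← hz]
      exact ext fun b => _root_.map_add φ ((y • f) b) ((z • f) b)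
    | tmul a x =>
      refine ext fun b => ?_
      rw [RingHom.id_apply, tmul_smul_apply]
      change φ (((a ⊗ₜ[k] x : K ⊗[k] S) • f) b) = _
      rw [tmul_smul_apply, map_smul]
      rfl

@[simp] theorem map_apply (φ : M →ₗ[S] N) (f : HomExt k K M) (b : K) :
    HomExt.map K φ f b = φ (f b) := rfl

/-- Pointwise solutions can be chosen linearly because the vector space `K` is projective over `k`.
This makes `M ↦ M ^ K` exact. -/
theorem exists_comp_eq {P Q : Type*} [AddCommGroup P] [Module k P] [AddCommGroup Q] [Module k Q]
    (φ : P →ₗ[k] Q) (f : HomExt k K Q) (hf : ∀ b, ∃ m, φ m = f b) :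
    ∃ g : HomExt k K P, ∀ b, φ (g b) = f b := by
  have hf' : ∀ b, f.toLin b ∈ LinearMap.range φ := hf
  obtain ⟨g, hg⟩ := Module.projective_lifting_property φ.rangeRestrict (f.toLin.codRestrict _ hf')
    φ.surjective_rangeRestrict
  exact ⟨ofLin g, fun b => congrArg Subtype.val (LinearMap.congr_fun hg b)⟩

theorem exists_apply_one (m : M) : ∃ f : HomExt k K M, f 1 = m := by
  obtain ⟨π, hπ⟩ := LinearMap.exists_leftInverse_of_injective (Algebra.linearMap k K)
    (LinearMap.ker_eq_bot.2 (algebraMap k K).injective)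
  refine ⟨ofLin (LinearMap.toSpanSingleton k M m ∘ₗ π), ?_⟩
  have : π 1 = 1 := by simpa using LinearMap.congr_fun hπ 1
  simp [this]

end

end HomExt

/-! ### Pencils of linear maps over a transcendental extension. -/

section Kronecker

open Polynomial

variable {k L : Type*} [Field k] [Field L] [Algebra k L] [IsAlgClosed L]

/-- Over `L` the polynomial `q` is a nonzero constant times factors `X - l`, each invertible on `U ^
L`; bijectivity then descends to `U`. -/
theorem bijective_smul_of_ne_zero {U : Type*} [AddCommGroup U] [Module k U] [Module k[X] U]
    [IsScalarTower k k[X] U]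
    (H : ∀ l : L, Function.Bijective fun F : HomExt k L U =>
      (1 ⊗ₜ[k] X - l ⊗ₜ[k] 1 : L ⊗[k] k[X]) • F) {q : k[X]} (hq : q ≠ 0) :
    Function.Bijective fun u : U => q • u := by
  have hmul : ∀ y z : L ⊗[k] k[X], (Function.Bijective fun F : HomExt k L U => y • F) →
      (Function.Bijective fun F : HomExt k L U => z • F) →
      Function.Bijective fun F : HomExt k L U => (y * z) • F := fun y z hy hz => by
    simp only [mul_smul]
    exact hy.comp hz
  have hone : Function.Bijective fun F : HomExt k L U => (1 : L ⊗[k] k[X]) • F := by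
    simp only [one_smul]
    exact Function.bijective_id
  have hC : ∀ l : L, l ≠ 0 →
      Function.Bijective fun F : HomExt k L U => (l ⊗ₜ[k] 1 : L ⊗[k] k[X]) • F := by
    intro l hl
    refine Function.bijective_iff_has_inverse.2
      ⟨fun F => (l⁻¹ ⊗ₜ[k] 1 : L ⊗[k] k[X]) • F, fun F => ?_, fun F => ?_⟩ <;>
    simp [smul_smul, hl, ← Algebra.TensorProduct.one_def]
  have hq' : q.map (algebraMap k L) ≠ 0 := (Polynomial.map_ne_zero_iff (algebraMap k L).injective).2 hq
  have himg : (1 ⊗ₜ[k] q : L ⊗[k] k[X]) =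
      Polynomial.aeval (1 ⊗ₜ[k] X : L ⊗[k] k[X]) (q.map (algebraMap k L)) := by
    rw [Polynomial.aeval_map_algebraMap]
    have := Polynomial.aeval_algHom_apply (Algebra.TensorProduct.includeRight : k[X] →ₐ[k] L ⊗[k] k[X]) X q
    simpa using this.symm
  have hbij : Function.Bijective fun F : HomExt k L U => (1 ⊗ₜ[k] q : L ⊗[k] k[X]) • F := by
    rw [himg, (IsAlgClosed.splits (q.map (algebraMap k L))).eq_prod_roots, _root_.map_mul,
      map_multiset_prod, Multiset.map_map]
    refine hmul _ _ ?_ (Multiset.prod_induction _ _ hmul hone ?_)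
    · rw [Polynomial.aeval_C, Algebra.TensorProduct.algebraMap_apply, Algebra.algebraMap_self_apply]
      exact hC _ (Polynomial.leadingCoeff_ne_zero.2 hq')
    · intro z hz
      obtain ⟨l, -, rfl⟩ := Multiset.mem_map.1 hz
      simpa [Algebra.TensorProduct.algebraMap_apply] using H l
  constructor
  · intro u v huv
    obtain ⟨π, hπ⟩ := HomExt.exists_apply_one (k := k) (K := L) (1 : k)
    obtain ⟨F, hF⟩ : ∃ F : HomExt k L U, ∀ b, F b = π b • (u - v) :=
      ⟨HomExt.ofLin (LinearMap.toSpanSingleton k U (u - v) ∘ₗ π.toLin), fun b => rfl⟩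
    have : F = 0 := hbij.1 <| HomExt.ext fun b => by
      have h0 : q • (u - v) = 0 := by rw [smul_sub]; exact sub_eq_zero.2 huv
      simp [hF, smul_comm q (π b), h0]
    have h1 := hF 1
    rw [this, hπ, one_smul, HomExt.zero_apply] at h1
    exact sub_eq_zero.1 h1.symm
  · intro u
    obtain ⟨F, hF⟩ := HomExt.exists_apply_one (k := k) (K := L) u
    obtain ⟨G, rfl⟩ := hbij.2 F
    exact ⟨G 1, by simpa using hF⟩

theorem baer_of_bijective_smul {U : Type*} [AddCommGroup U] [Module k[X] U]
    (h : ∀ q : k[X], q ≠ 0 → Function.Surjective fun u : U => q • u) : Module.Baer k[X] U := by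
  intro I g
  obtain ⟨q, rfl⟩ := (IsPrincipalIdealRing.principal I).principal
  by_cases hq : q = 0
  · refine ⟨0, fun x hx => ?_⟩
    have : (⟨x, hx⟩ : Ideal.span {q}) = 0 := by
      subst hq; exact Subtype.ext (by simpa using hx)
    erw [this]; simp
  · obtain ⟨u, hu⟩ := h q hq (g ⟨q, Ideal.mem_span_singleton_self q⟩)
    refine ⟨LinearMap.toSpanSingleton _ _ u, fun x hx => ?_⟩
    obtain ⟨c, rfl⟩ := Ideal.mem_span_singleton'.1 hx
    have : (⟨c * q, hx⟩ : Ideal.span {q}) = c • ⟨q, Ideal.mem_span_singleton_self q⟩ := rfl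
    erw [this, map_smul, ← hu]
    simp [mul_smul]

/-- `U` is divisible, hence injective over `k[X]`. So the map `1 ↦ u` extends along the embedding
`k[X] → L`, `X ↦ t`, and the extension `θ` satisfies `(X - t) θ = 0`. -/
theorem subsingleton_of_bijective_smul {t : L} (ht : Transcendental k t) {U : Type*}
    [AddCommGroup U] [Module k U] [Module k[X] U] [IsScalarTower k k[X] U]
    (H : ∀ l : L, Function.Bijective fun F : HomExt k L U =>
      (1 ⊗ₜ[k] X - l ⊗ₜ[k] 1 : L ⊗[k] k[X]) • F) : Subsingleton U := by
  refine subsingleton_of_forall_eq 0 fun u => ?_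
  let ψ : k[X] →ₗ[k[X]] Module.AEval k L t :=
    LinearMap.toSpanSingleton k[X] _ (Module.AEval.of k L t 1)
  have hψ : ∀ q, ψ q = Module.AEval.of k L t (aeval t q) := fun q => by
    simp only [ψ, LinearMap.toSpanSingleton_apply]
    rw [← Module.AEval.of_aeval_smul, smul_eq_mul, mul_one]
  have hinj : Function.Injective ψ := by
    intro q q' h
    rw [hψ, hψ] at h
    exact (transcendental_iff_injective.1 ht) ((Module.AEval.of k L t).injective h)
  obtain ⟨θ, hθ⟩ := (baer_of_bijective_smul fun q hq =>
    (bijective_smul_of_ne_zero H hq).2).extension_property ψ hinj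
      (LinearMap.toSpanSingleton k[X] U u)
  let F : HomExt k L U := HomExt.ofLin
    (θ.restrictScalars k ∘ₗ (Module.AEval.of k L t).toLinearMap)
  have hF : ∀ b, F b = θ (Module.AEval.of k L t b) := fun b => rfl
  have h0 : F = 0 := (H t).1 <| HomExt.ext fun b => by
    simp only [sub_smul, HomExt.sub_apply, HomExt.one_tmul_smul_apply, HomExt.tmul_one_smul_apply,
      hF, ← map_smul, Module.AEval.X_smul_of, smul_eq_mul, sub_self, smul_zero, HomExt.zero_apply]
  have h1 : F 1 = u := by
    have := LinearMap.congr_fun hθ 1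
    rw [LinearMap.comp_apply, hψ, map_one] at this
    simpa [hF] using this
  rw [← h1, h0, HomExt.zero_apply]

/-- A pair of linear maps `f, g : U → V`, all of whose nontrivial combinations over a
transcendental algebraically closed extension are invertible, is trivial. -/
theorem subsingleton_of_bijective_pencil {t : L} (ht : Transcendental k t) {U V : Type*}
    [AddCommGroup U] [Module k U] [AddCommGroup V] [Module k V] (f g : U →ₗ[k] V)
    (H : ∀ l m : L, (l ≠ 0 ∨ m ≠ 0) → Function.Bijective fun F : L →ₗ[k] U =>
      (f ∘ₗ F ∘ₗ LinearMap.mulLeft k l + g ∘ₗ F ∘ₗ LinearMap.mulLeft k m : L →ₗ[k] V)) :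
    Subsingleton U := by
  have Hf : Function.Bijective fun F : L →ₗ[k] U => f ∘ₗ F := by
    have := H 1 0 (Or.inl one_ne_zero)
    simpa [LinearMap.mulLeft_one] using this
  have hf : Function.Bijective f := by
    obtain ⟨π, hπ⟩ := HomExt.exists_apply_one (k := k) (K := L) (1 : k)
    have hπ' : π.toLin 1 = 1 := hπ
    refine ⟨fun u v huv => ?_, fun v => ?_⟩
    · have : LinearMap.toSpanSingleton k U u ∘ₗ π.toLin =
          LinearMap.toSpanSingleton k U v ∘ₗ π.toLin := Hf.1 <| LinearMap.ext fun b => by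
        simp only [LinearMap.comp_apply, LinearMap.toSpanSingleton_apply, map_smul, huv]
      simpa [hπ] using LinearMap.congr_fun this 1
    · obtain ⟨F, hF⟩ := Hf.2 (LinearMap.toSpanSingleton k V v ∘ₗ π.toLin)
      exact ⟨F 1, by simpa [hπ] using LinearMap.congr_fun hF 1⟩
  let e : U ≃ₗ[k] V := LinearEquiv.ofBijective f hf
  -- The pencil becomes the single endomorphism `f⁻¹ g`, and `X - l` corresponds to the combination
  -- with coefficients `(-l, 1)`.
  let T : Module.End k U := e.symm.toLinearMap ∘ₗ g
  have hT : ∀ u, f (T u) = g u := fun u => e.apply_symm_apply (g u)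
  let A := Module.AEval k U T
  let o : U ≃ₗ[k] A := Module.AEval.of k U T
  suffices Subsingleton A from o.toEquiv.subsingleton
  refine subsingleton_of_bijective_smul ht fun l => ?_
  have key : ∀ (F : HomExt k L A),
      f ∘ₗ (o.symm.toLinearMap ∘ₗ ((1 ⊗ₜ[k] X - l ⊗ₜ[k] 1 : L ⊗[k] k[X]) • F).toLin) =
      f ∘ₗ (o.symm.toLinearMap ∘ₗ F.toLin) ∘ₗ LinearMap.mulLeft k (-l) +
        g ∘ₗ (o.symm.toLinearMap ∘ₗ F.toLin) ∘ₗ LinearMap.mulLeft k 1 := by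
    intro F
    refine LinearMap.ext fun b => ?_
    have hX : ∀ a : A, o.symm (X • a) = T (o.symm a) := fun a => by
      rw [LinearEquiv.symm_apply_eq]
      conv_lhs => rw [← o.apply_symm_apply a]
      exact Module.AEval.X_smul_of (R := k) (M := U) T _
    have e1 : ((1 ⊗ₜ[k] X - l ⊗ₜ[k] 1 : L ⊗[k] k[X]) • F) b = (X : k[X]) • F b - F (l * b) := by
      rw [sub_smul, HomExt.sub_apply, HomExt.one_tmul_smul_apply, HomExt.tmul_one_smul_apply]
    have e2 : F.toLin (-l * b) = -F (l * b) := by rw [neg_mul, _root_.map_neg]; rfl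
    simp only [LinearMap.comp_apply, LinearMap.add_apply, HomExt.toLin_apply, e1,
      LinearMap.mulLeft_apply, one_mul, LinearEquiv.coe_coe, map_sub, hX, hT]
    rw [← HomExt.toLin_apply F (-l * b), e2, map_neg, map_neg]
    abel
  have hb := H (-l) 1 (Or.inr one_ne_zero)
  refine ⟨fun F G hFG => ?_, fun G => ?_⟩
  · have h2 := hb.1 (a₁ := o.symm.toLinearMap ∘ₗ F.toLin) (a₂ := o.symm.toLinearMap ∘ₗ G.toLin) (by
      simp only [← key]
      exact congrArg (fun z : HomExt k L A => f ∘ₗ (o.symm.toLinearMap ∘ₗ z.toLin)) hFG)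
    exact HomExt.ext fun b => o.symm.injective (LinearMap.congr_fun h2 b)
  · obtain ⟨F, hF⟩ := hb.2 (f ∘ₗ o.symm.toLinearMap ∘ₗ G.toLin)
    refine ⟨HomExt.ofLin (o.toLinearMap ∘ₗ F), HomExt.ext fun b => ?_⟩
    have hF' : o.symm.toLinearMap ∘ₗ (HomExt.ofLin (o.toLinearMap ∘ₗ F)).toLin = F :=
      LinearMap.ext fun b => o.symm_apply_apply (F b)
    have h3 := key (HomExt.ofLin (o.toLinearMap ∘ₗ F))
    rw [hF'] at h3
    exact o.symm.injective (hf.1 (LinearMap.congr_fun (h3.trans hF) b))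

end Kronecker


/-! ### Tate cohomology of two commuting elements. -/

section RankTwoDescent

variable {p : ℕ} {S W : Type*} [CommRing S] [AddCommGroup W] [Module S W]
  {t₁ t₂ : S}

/-- The elements of `W` killed by `t₁ ^ (p - 1) * t₂ ^ (p - 1)`. -/
abbrev RankTwo.ker (p : ℕ) (t₁ t₂ : S) (W : Type*) [AddCommGroup W] [Module S W] :
    Submodule S W :=
  LinearMap.ker (LinearMap.lsmul S W (t₁ ^ (p - 1) * t₂ ^ (p - 1)))

/-- The cocycles of degree one with values in `W`. -/
def RankTwo.cocycles (p : ℕ) (t₁ t₂ : S) (W : Type*) [AddCommGroup W] [Module S W] :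
    Submodule S (W × W) where
  carrier := {z | t₁ • z.2 = t₂ • z.1 ∧ t₁ ^ (p - 1) • z.1 = 0 ∧ t₂ ^ (p - 1) • z.2 = 0}
  add_mem' := by
    rintro a b ⟨h1, h2, h3⟩ ⟨h1', h2', h3'⟩
    simp [h1, h2, h3, h1', h2', h3']
  zero_mem' := by simp
  smul_mem' := by
    rintro c a ⟨h1, h2, h3⟩
    simp [smul_comm _ c, h1, h2, h3]

theorem pow_sub_one_smul_smul (hp : p ≠ 0) {t : S} (ht : t ^ p = 0) (w : W) :
    t ^ (p - 1) • t • w = 0 := by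
  rw [smul_smul, ← pow_succ, Nat.sub_add_cancel (Nat.one_le_iff_ne_zero.2 hp), ht, zero_smul]

theorem smul_pow_sub_one_smul (hp : p ≠ 0) {t : S} (ht : t ^ p = 0) (w : W) :
    t • t ^ (p - 1) • w = 0 := by
  rw [smul_comm, pow_sub_one_smul_smul hp ht]

/-- The map `(u, v) ↦ t₁ u + t₂ v`. -/
def RankTwo.sum (hp : p ≠ 0) (h₁ : t₁ ^ p = 0) (h₂ : t₂ ^ p = 0) :
    W × W →ₗ[S] RankTwo.ker p t₁ t₂ W :=
  ((LinearMap.lsmul S W t₁).coprod (LinearMap.lsmul S W t₂)).codRestrict _ fun z => by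
    simp only [LinearMap.mem_ker, LinearMap.coprod_apply, LinearMap.lsmul_apply, smul_add]
    rw [mul_smul, mul_smul, pow_sub_one_smul_smul hp h₂, smul_comm (t₂ ^ (p - 1)) t₁,
      pow_sub_one_smul_smul hp h₁, smul_zero, add_zero]

/-- The coboundary map `w ↦ (t₁ w, t₂ w)`. -/
def RankTwo.cobound (hp : p ≠ 0) (h₁ : t₁ ^ p = 0) (h₂ : t₂ ^ p = 0) :
    W →ₗ[S] RankTwo.cocycles p t₁ t₂ W :=
  ((LinearMap.lsmul S W t₁).prod (LinearMap.lsmul S W t₂)).codRestrict _ fun _ =>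
    ⟨smul_comm _ _ _, pow_sub_one_smul_smul hp h₁ _, pow_sub_one_smul_smul hp h₂ _⟩

/-- The cocycle `(t₂ ^ (p - 1) w, 0)`. -/
def RankTwo.fstCocycle (hp : p ≠ 0) (h₂ : t₂ ^ p = 0) :
    RankTwo.ker p t₁ t₂ W →ₗ[S] RankTwo.cocycles p t₁ t₂ W :=
  (((LinearMap.lsmul S W (t₂ ^ (p - 1))).prod 0).comp (Submodule.subtype _)).codRestrict _
    fun w => ⟨by simp [smul_pow_sub_one_smul hp h₂], by
      have := LinearMap.mem_ker.1 w.2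
      rwa [LinearMap.lsmul_apply, mul_smul] at this, by simp⟩

/-- The cocycle `(0, t₁ ^ (p - 1) w)`. -/
def RankTwo.sndCocycle (hp : p ≠ 0) (h₁ : t₁ ^ p = 0) :
    RankTwo.ker p t₁ t₂ W →ₗ[S] RankTwo.cocycles p t₁ t₂ W :=
  ((LinearMap.prod 0 (LinearMap.lsmul S W (t₁ ^ (p - 1)))).comp (Submodule.subtype _)).codRestrict _
    fun w => ⟨by simp [smul_pow_sub_one_smul hp h₁], by simp, by
      have := LinearMap.mem_ker.1 w.2
      rwa [LinearMap.lsmul_apply, mul_comm, mul_smul] at this⟩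

/-- Elements of `Hom_k(L, U)` and `Hom_k(L, V)` are lifted to `W ^ L` and to pairs in it, where
`rankTwo_injective` and `rankTwo_surjective` apply. -/
theorem RankTwo.bijective [Fact p.Prime] {k L : Type*} [Field k] [CharP k p] [Field L]
    [Algebra k L] [IsAlgClosed L] [Algebra k S] [Module k W] [IsScalarTower k S W]
    (hp : p ≠ 0) (h₁ : t₁ ^ p = 0) (h₂ : t₂ ^ p = 0)
    (hx : ∀ l m : L, (l ≠ 0 ∨ m ≠ 0) → ∀ F : HomExt k L W,
      (l ⊗ₜ[k] t₁ + m ⊗ₜ[k] t₂ : L ⊗[k] S) ^ (p - 1) • F = 0 →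
        ∃ G, F = (l ⊗ₜ[k] t₁ + m ⊗ₜ[k] t₂ : L ⊗[k] S) • G)
    {U V : Type*} [AddCommGroup U] [Module S U] [Module k U] [IsScalarTower k S U]
    [AddCommGroup V] [Module S V] [Module k V] [IsScalarTower k S V]
    (f g : U →ₗ[S] V) (πU : RankTwo.ker p t₁ t₂ W →ₗ[S] U)
    (πV : RankTwo.cocycles p t₁ t₂ W →ₗ[S] V) (hsU : Function.Surjective πU)
    (hsV : Function.Surjective πV)
    (hkU : ∀ z, πU z = 0 ↔ ∃ y, RankTwo.sum hp h₁ h₂ y = z)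
    (hkV : ∀ z, πV z = 0 ↔ ∃ y, RankTwo.cobound hp h₁ h₂ y = z)
    (hfπ : ∀ z, f (πU z) = πV (RankTwo.fstCocycle hp h₂ z))
    (hgπ : ∀ z, g (πU z) = πV (RankTwo.sndCocycle hp h₁ z)) {l₀ m₀ : L}
    (h₀ : l₀ ≠ 0 ∨ m₀ ≠ 0) : Function.Bijective fun F : L →ₗ[k] U =>
      (f.restrictScalars k ∘ₗ F ∘ₗ LinearMap.mulLeft k l₀ +
        g.restrictScalars k ∘ₗ F ∘ₗ LinearMap.mulLeft k m₀ : L →ₗ[k] V) := by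
  have : CharP L p := charP_of_injective_algebraMap (algebraMap k L).injective p
  let δ : W →ₗ[S] RankTwo.cocycles p t₁ t₂ W := RankTwo.cobound hp h₁ h₂
  let f₀ : RankTwo.ker p t₁ t₂ W →ₗ[S] RankTwo.cocycles p t₁ t₂ W := RankTwo.fstCocycle hp h₂
  let g₀ : RankTwo.ker p t₁ t₂ W →ₗ[S] RankTwo.cocycles p t₁ t₂ W := RankTwo.sndCocycle hp h₁
  have hδ : ∀ z, (δ z : W × W) = (t₁ • z, t₂ • z) := fun _ => rfl
  have hf₀ : ∀ z, (f₀ z : W × W) = (t₂ ^ (p - 1) • (z : W), 0) := fun _ => rfl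
  have hg₀ : ∀ z, (g₀ z : W × W) = (0, t₁ ^ (p - 1) • (z : W)) := fun _ => rfl
  change ∀ z, _ = πV (f₀ z) at hfπ
  change ∀ z, _ = πV (g₀ z) at hgπ
  -- The form `l t₁ + m t₂` controls the combination with coefficients `(-m ^ p, l ^ p)`, so `p`-th
  -- roots of `-l₀` and `m₀` are needed.
  obtain ⟨m, hm⟩ := IsAlgClosed.exists_pow_nat_eq (-l₀) (Fact.out : p.Prime).pos
  obtain ⟨l, hl⟩ := IsAlgClosed.exists_pow_nat_eq m₀ (Fact.out : p.Prime).pos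
  have hlm : l ≠ 0 ∨ m ≠ 0 := by
    by_contra! hcon
    rw [hcon.2, zero_pow hp, eq_comm, neg_eq_zero] at hm
    rw [hcon.1, zero_pow hp] at hl
    exact h₀.elim (fun h => h hm) fun h => h hl.symm
  obtain ⟨l', m', hdet⟩ : ∃ l' m' : L, l * m' - m * l' = 1 := by
    rcases hlm with h | h
    · exact ⟨0, l⁻¹, by simp [h]⟩
    · exact ⟨-m⁻¹, 0, by simp [h]⟩
  let i : L →ₐ[k] L ⊗[k] S := Algebra.TensorProduct.includeLeft
  have hi : ∀ a, i a = a ⊗ₜ 1 := fun _ => rfl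
  let j : S →ₐ[k] L ⊗[k] S := Algebra.TensorProduct.includeRight
  have hj : ∀ a, j a = 1 ⊗ₜ a := fun _ => rfl
  have hdet' : i l * i m' - i m * i l' = 1 := by
    rw [← map_mul, ← map_mul, ← map_sub, hdet, map_one]
  have hxl : i l * j t₁ + i m * j t₂ = (l ⊗ₜ[k] t₁ + m ⊗ₜ[k] t₂ : L ⊗[k] S) := by
    simp [hi, hj]
  have hx' := hx l m hlm
  rw [← hxl] at hx'
  have el : i l ^ p * j t₁ ^ (p - 1) = m₀ ⊗ₜ (t₁ ^ (p - 1)) := by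
    rw [← map_pow, ← map_pow, hl, hi, hj, Algebra.TensorProduct.tmul_mul_tmul, mul_one, one_mul]
  have em : i m ^ p * j t₂ ^ (p - 1) = (-l₀) ⊗ₜ (t₂ ^ (p - 1)) := by
    rw [← map_pow, ← map_pow, hm, hi, hj, Algebra.TensorProduct.tmul_mul_tmul, mul_one, one_mul]
  have hnorm : j t₁ ^ (p - 1) * j t₂ ^ (p - 1) = j (t₁ ^ (p - 1) * t₂ ^ (p - 1)) := by
    rw [map_mul, map_pow, map_pow]
  constructor
  · suffices h : ∀ F : L →ₗ[k] U,
        (∀ b, f (F (l₀ * b)) + g (F (m₀ * b)) = 0) → F = 0 by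
      intro F G hFG
      refine sub_eq_zero.1 (h (F - G) fun b => ?_)
      have := LinearMap.congr_fun hFG b
      simp only [LinearMap.add_apply, LinearMap.comp_apply, LinearMap.mulLeft_apply,
        LinearMap.restrictScalars_apply] at this
      rw [LinearMap.sub_apply, LinearMap.sub_apply, map_sub, map_sub, sub_add_sub_comm, this,
        sub_self]
    intro F hF
    obtain ⟨F₁, hF₁⟩ := HomExt.exists_comp_eq (πU.restrictScalars k) (HomExt.ofLin F)
      fun b => hsU _
    have hF₁' : ∀ b, πU (F₁ b) = F b := hF₁
    let E : HomExt k L (RankTwo.cocycles p t₁ t₂ W) := HomExt.ofLin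
      (f₀.restrictScalars k ∘ₗ F₁.toLin ∘ₗ LinearMap.mulLeft k l₀ +
        g₀.restrictScalars k ∘ₗ F₁.toLin ∘ₗ LinearMap.mulLeft k m₀)
    have hE : ∀ b, E b = f₀ (F₁ (l₀ * b)) + g₀ (F₁ (m₀ * b)) := fun _ => rfl
    obtain ⟨G, hG⟩ := HomExt.exists_comp_eq (δ.restrictScalars k) E fun b => by
      have h0 : πV (E b) = 0 := by
        rw [hE, map_add, ← hfπ, ← hgπ, hF₁', hF₁', hF]
      exact (hkV _).1 h0
    have hG' : ∀ b, (t₁ • G b, t₂ • G b) =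
        (t₂ ^ (p - 1) • (F₁ (l₀ * b) : W), t₁ ^ (p - 1) • (F₁ (m₀ * b) : W)) := fun b => by
      rw [← hδ]
      refine (congrArg Subtype.val (hG b)).trans ?_
      rw [hE, Submodule.coe_add, hf₀, hg₀]
      simp
    obtain ⟨u, v, huv⟩ := rankTwo_injective (p := p) L (t₁ := j t₁) (t₂ := j t₂) hdet' hx'
      (h := HomExt.map L (Submodule.subtype _) F₁) (G := G)
      (HomExt.ext fun b => by
        rw [em, ← TensorProduct.neg_tmul, neg_neg, HomExt.tmul_smul_apply, hj,
          HomExt.one_tmul_smul_apply]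
        exact (Prod.ext_iff.1 (hG' b)).1)
      (HomExt.ext fun b => by
        rw [el, HomExt.tmul_smul_apply, hj, HomExt.one_tmul_smul_apply]
        exact (Prod.ext_iff.1 (hG' b)).2)
    refine LinearMap.ext fun b => ?_
    rw [← hF₁', LinearMap.zero_apply]
    refine (hkU _).2 ⟨(u b, v b), Subtype.ext ?_⟩
    have := congrArg (fun z : HomExt k L W => z b) huv
    simp only [HomExt.map_apply, HomExt.add_apply, hj, HomExt.one_tmul_smul_apply] at this
    exact this.symm
  · intro E
    obtain ⟨E₁, hE₁⟩ := HomExt.exists_comp_eq (πV.restrictScalars k) (HomExt.ofLin E)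
      fun b => hsV _
    have hE₁' : ∀ b, πV (E₁ b) = E b := hE₁
    let a := HomExt.map L (LinearMap.fst S W W ∘ₗ Submodule.subtype _) E₁
    let c := HomExt.map L (LinearMap.snd S W W ∘ₗ Submodule.subtype _) E₁
    have ha : ∀ b, a b = (E₁ b : W × W).1 := fun _ => rfl
    have hc : ∀ b, c b = (E₁ b : W × W).2 := fun _ => rfl
    obtain ⟨h, G, hh, hha, hhc⟩ := rankTwo_surjective (p := p) L (t₁ := j t₁) (t₂ := j t₂)
      (by rw [← map_pow, h₁, map_zero]) (by rw [← map_pow, h₂, map_zero]) hdet' hx'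
      (a := a) (b := c)
      (HomExt.ext fun b => by
        rw [hj, hj, HomExt.one_tmul_smul_apply, HomExt.one_tmul_smul_apply]
        exact (E₁ b).2.1)
      (HomExt.ext fun b => by
        rw [← map_pow, hj, HomExt.one_tmul_smul_apply]
        exact (E₁ b).2.2.1)
      (HomExt.ext fun b => by
        rw [← map_pow, hj, HomExt.one_tmul_smul_apply]
        exact (E₁ b).2.2.2)
    rw [em, ← TensorProduct.neg_tmul, neg_neg] at hha
    rw [el] at hhc
    let F₁ : L →ₗ[k] RankTwo.ker p t₁ t₂ W :=
      h.toLin.codRestrict ((RankTwo.ker p t₁ t₂ W).restrictScalars k) fun b => by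
        have : ((1 ⊗ₜ (t₁ ^ (p - 1) * t₂ ^ (p - 1)) : L ⊗[k] S) • h) b = 0 := by
          rw [← hj, ← hnorm, hh, HomExt.zero_apply]
        rwa [HomExt.one_tmul_smul_apply] at this
    have hF₁ : ∀ b, (F₁ b : W) = h b := fun _ => rfl
    refine ⟨πU.restrictScalars k ∘ₗ F₁, LinearMap.ext fun b => ?_⟩
    simp only [LinearMap.add_apply, LinearMap.comp_apply, LinearMap.mulLeft_apply,
      LinearMap.restrictScalars_apply]
    rw [hfπ, hgπ, ← map_add, ← hE₁', eq_comm, ← sub_eq_zero, ← map_sub]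
    refine (hkV _).2 ⟨G b, Subtype.ext ?_⟩
    rw [hδ, Submodule.coe_sub, Submodule.coe_add, hf₀, hg₀, hF₁, hF₁]
    have h3 := congrArg (fun z : HomExt k L W => z b) hha
    have h4 := congrArg (fun z : HomExt k L W => z b) hhc
    simp only [HomExt.add_apply, HomExt.tmul_smul_apply, hj, one_mul, ha, hc] at h3 h4
    refine Prod.ext ?_ ?_
    · simp [h3]
    · simp [h4]

theorem exists_eq_smul_add_smul [Fact p.Prime] {k L : Type*} [Field k] [CharP k p] [Field L] [Algebra k L]
    [IsAlgClosed L] {t : L} (ht : Transcendental k t) [Algebra k S] [Module k W]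
    [IsScalarTower k S W] (h₁ : t₁ ^ p = 0) (h₂ : t₂ ^ p = 0)
    (hx : ∀ l m : L, (l ≠ 0 ∨ m ≠ 0) → ∀ F : HomExt k L W,
      (l ⊗ₜ[k] t₁ + m ⊗ₜ[k] t₂ : L ⊗[k] S) ^ (p - 1) • F = 0 →
        ∃ G, F = (l ⊗ₜ[k] t₁ + m ⊗ₜ[k] t₂ : L ⊗[k] S) • G)
    {w : W} (hw : (t₁ ^ (p - 1) * t₂ ^ (p - 1)) • w = 0) : ∃ u v, w = t₁ • u + t₂ • v := by
  have hp : p ≠ 0 := (Fact.out : p.Prime).ne_zero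
  let ε : W × W →ₗ[S] RankTwo.ker p t₁ t₂ W := RankTwo.sum hp h₁ h₂
  let δ : W →ₗ[S] RankTwo.cocycles p t₁ t₂ W := RankTwo.cobound hp h₁ h₂
  let f₀ : RankTwo.ker p t₁ t₂ W →ₗ[S] RankTwo.cocycles p t₁ t₂ W := RankTwo.fstCocycle hp h₂
  let g₀ : RankTwo.ker p t₁ t₂ W →ₗ[S] RankTwo.cocycles p t₁ t₂ W := RankTwo.sndCocycle hp h₁
  have hε : ∀ z, (ε z : W) = t₁ • z.1 + t₂ • z.2 := fun _ => rfl
  have hδ : ∀ z, (δ z : W × W) = (t₁ • z, t₂ • z) := fun _ => rfl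
  have hf₀ : ∀ z, (f₀ z : W × W) = (t₂ ^ (p - 1) • (z : W), 0) := fun _ => rfl
  have hg₀ : ∀ z, (g₀ z : W × W) = (0, t₁ ^ (p - 1) • (z : W)) := fun _ => rfl
  let U := RankTwo.ker p t₁ t₂ W ⧸ LinearMap.range ε
  let V := RankTwo.cocycles p t₁ t₂ W ⧸ LinearMap.range δ
  let f : U →ₗ[S] V := Submodule.mapQ _ _ f₀ (by
    rintro _ ⟨⟨u, v⟩, rfl⟩
    refine ⟨t₂ ^ (p - 1) • u, Subtype.ext ?_⟩
    rw [hδ, hf₀, hε]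
    simp [smul_comm _ t₁, pow_sub_one_smul_smul hp h₂, smul_pow_sub_one_smul hp h₂])
  let g : U →ₗ[S] V := Submodule.mapQ _ _ g₀ (by
    rintro _ ⟨⟨u, v⟩, rfl⟩
    refine ⟨t₁ ^ (p - 1) • v, Subtype.ext ?_⟩
    rw [hδ, hg₀, hε]
    simp [smul_comm _ t₂, pow_sub_one_smul_smul hp h₁, smul_pow_sub_one_smul hp h₁])
  let πU : RankTwo.ker p t₁ t₂ W →ₗ[S] U := Submodule.mkQ _
  let πV : RankTwo.cocycles p t₁ t₂ W →ₗ[S] V := Submodule.mkQ _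
  have hfπ : ∀ z, f (πU z) = πV (f₀ z) := fun _ => rfl
  have hgπ : ∀ z, g (πU z) = πV (g₀ z) := fun _ => rfl
  suffices hU : Subsingleton U by
    have h0 : πU ⟨w, hw⟩ = 0 := Subsingleton.elim _ _
    obtain ⟨⟨u, v⟩, huv⟩ := (Submodule.Quotient.mk_eq_zero _).1 h0
    exact ⟨u, v, (congrArg Subtype.val huv).symm⟩
  refine subsingleton_of_bijective_pencil ht (f.restrictScalars k) (g.restrictScalars k)
    fun l₀ m₀ h₀ => RankTwo.bijective hp h₁ h₂ hx f g πU πV (Submodule.mkQ_surjective _)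
      (Submodule.mkQ_surjective _) (fun z => Submodule.Quotient.mk_eq_zero _)
      (fun z => Submodule.Quotient.mk_eq_zero _) hfπ hgπ h₀

end RankTwoDescent


/-! ### Frobenius on sums, and intermediate fields of transcendence degree one. -/

theorem sum_pow_char_eq_zero {p : ℕ} [Fact p.Prime] (L : Type*) [Field L] [CharP L p]
    {Q ι : Type*} [CommRing Q] [Algebra L Q] (J : Finset ι) (f : ι → Q)
    (hf : ∀ i ∈ J, f i ^ p = 0) : (∑ i ∈ J, f i) ^ p = 0 := by
  classical
  have hp0 : (p : Q) = 0 := by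
    rw [← map_natCast (algebraMap L Q), CharP.cast_eq_zero, map_zero]
  induction J using Finset.induction_on with
  | empty => exact zero_pow (Fact.out : p.Prime).ne_zero
  | insert i J hi ih =>
    obtain ⟨r, hr⟩ := exists_add_pow_prime_eq (Fact.out : p.Prime) (f i) (∑ c ∈ J, f c)
    rw [Finset.sum_insert hi, hr, ih fun c hc => hf c (Finset.mem_insert_of_mem hc),
      hf i (Finset.mem_insert_self _ _), hp0]
    ring

theorem trdeg_eq_of_isAlgebraic.{u, v} (k : Type u) (E : Type v) {L : Type v} [CommRing k] [IsDomain k] [CommRing E]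
    [IsDomain E] [CommRing L] [IsDomain L] [Algebra k E] [Algebra k L] [Algebra E L]
    [IsScalarTower k E L] [FaithfulSMul k E] [FaithfulSMul E L] [Algebra.IsAlgebraic E L] :
    Algebra.trdeg k E = Algebra.trdeg k L := by
  rw [← trdeg_add_eq k E (A := L), trdeg_eq_zero (R := E) (A := L), add_zero]

theorem trdeg_adjoin_simple_le {k K : Type*} [Field k] [Field K] [Algebra k K] (t : K) :
    Algebra.trdeg k (IntermediateField.adjoin k {t}) ≤ 1 := by
  have h : ∀ A : Subalgebra k K, A = (Polynomial.aeval (R := k) t).range →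
      Algebra.trdeg k A ≤ 1 := by
    rintro _ rfl
    simpa [Polynomial.trdeg_of_isDomain] using
      lift_trdeg_le_of_surjective (Polynomial.aeval (R := k) t).rangeRestrict
        (Polynomial.aeval (R := k) t).rangeRestrict_surjective
  open scoped IntermediateField.algebraAdjoinAdjoin in
  rw [← trdeg_eq_of_isAlgebraic k (Algebra.adjoin k {t})]
  exact h _ (Algebra.adjoin_singleton_eq_range_aeval k t)

theorem exists_intermediate_isAlgClosed (k K : Type*) [Field k] [Field K] [Algebra k K]
    [IsAlgClosed K] {n : ℕ} (hn : ((n + 2 : ℕ) : Cardinal) ≤ Algebra.trdeg k K + 1) :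
    ∃ L : IntermediateField k K, IsAlgClosed L ∧ (∃ t : L, Transcendental k t) ∧
      ((n + 1 : ℕ) : Cardinal) ≤ Algebra.trdeg L K + 1 := by
  have hn' : ((n + 1 : ℕ) : Cardinal) ≤ Algebra.trdeg k K := by
    rw [← Cardinal.add_one_le_add_one_iff]
    exact_mod_cast hn
  have htr : Algebra.Transcendental k K := by
    rw [← trdeg_ne_zero_iff (R := k) (A := K)]
    intro h
    rw [h, ← Nat.cast_zero, Nat.cast_le] at hn'
    omega
  obtain ⟨t, ht⟩ := htr
  let E : IntermediateField k K := IntermediateField.adjoin k {t}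
  -- The closure of `k(t)` inside `K` is algebraically closed since `K` is, and it has transcendence
  -- degree at most one over `k`.
  let L : IntermediateField k K := (algebraicClosure E K).restrictScalars k
  have htL : t ∈ L := (algebraicClosure E K).algebraMap_mem
    ⟨t, IntermediateField.mem_adjoin_simple_self k t⟩
  have hL : IsAlgClosed L := (algebraicClosure.isAlgClosure (F := E) (E := K)).isAlgClosed
  refine ⟨L, hL, ⟨⟨t, htL⟩, fun h => ht ?_⟩, ?_⟩
  · exact (isAlgebraic_algebraMap_iff (algebraMap L K).injective).2 h
  · have h1 : Algebra.trdeg k L ≤ 1 := by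
      change Algebra.trdeg k (algebraicClosure E K) ≤ 1
      have : FaithfulSMul E (algebraicClosure E K) :=
        (faithfulSMul_iff_algebraMap_injective _ _).2 (algebraMap E (algebraicClosure E K)).injective
      rw [← trdeg_eq_of_isAlgebraic k E]
      exact trdeg_adjoin_simple_le t
    have h2 := trdeg_add_eq k L (A := K)
    rw [← h2] at hn'
    refine hn'.trans ?_
    rw [add_comm]
    gcongr

/-! ### Transitivity of coextension, and descent of the socle condition. -/

namespace HomExt

section

variable (k L M : Type*) [Field k] [Field L] [Algebra k L] [AddCommGroup M] [Module k M]

/-- `M ^ L` as a vector space over `L`. -/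
@[reducible] def scalarModule : Module L (HomExt k L M) :=
  Module.compHom (HomExt k L M) (scalarAction k L M).toRingHom

attribute [local instance] scalarModule

theorem scalarModule_smul_apply (l : L) (f : HomExt k L M) (b : L) :
    (l • f) b = f (l * b) := rfl

theorem isScalarTower_scalarModule (S : Type*) [CommRing S] [Algebra k S] [Module S M]
    [IsScalarTower k S M] :
    IsScalarTower L (L ⊗[k] S) (HomExt k L M) :=
  ⟨fun l z f => by
    have h : l • z = (l ⊗ₜ[k] 1 : L ⊗[k] S) * z := by
      rw [Algebra.smul_def, Algebra.TensorProduct.algebraMap_apply, Algebra.algebraMap_self_apply]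
    rw [h, mul_smul]
    exact ext fun b => tmul_one_smul_apply l (z • f) b⟩

end

section

variable {k L K M : Type*} [Field k] [Field L] [Algebra k L] [Field K] [Algebra k K]
  [Algebra L K] [IsScalarTower k L K] [AddCommGroup M] [Module k M]

attribute [local instance] scalarModule isScalarTower_scalarModule

/-- `(M ^ L) ^ K = M ^ K`. -/
def flatten :
    HomExt L K (HomExt k L M) ≃+ HomExt k K M :=
  { toFun := fun F => ofLin
      { toFun := fun b => F b 1
        map_add' := fun a b => by rw [map_add, add_apply]
        map_smul' := fun c b => by
          have h : F (c • b) = algebraMap k L c • F b := by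
            rw [← toLin_apply, ← algebraMap_smul L c b, map_smul, toLin_apply]
          rw [h, scalarModule_smul_apply, mul_one, Algebra.algebraMap_eq_smul_one,
            ← toLin_apply, map_smul, toLin_apply, RingHom.id_apply] }
    invFun := fun G => ofLin
      { toFun := fun b => ofLin
          { toFun := fun l => G (l • b)
            map_add' := fun l l' => by rw [add_smul, map_add]
            map_smul' := fun c l => by
              rw [smul_assoc, ← toLin_apply, map_smul, toLin_apply, RingHom.id_apply] }
        map_add' := fun a b => ext fun l => by
          simp only [ofLin_apply, LinearMap.coe_mk, AddHom.coe_mk, smul_add, map_add, add_apply]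
        map_smul' := fun l b => ext fun l' => by
          rw [RingHom.id_apply, scalarModule_smul_apply]
          simp only [ofLin_apply, LinearMap.coe_mk, AddHom.coe_mk, smul_smul, mul_comm l] }
    left_inv := fun F => ext fun b => ext fun l => by
      have h : F (l • b) = l • F b := by rw [← toLin_apply, map_smul, toLin_apply]
      simp only [ofLin_apply, LinearMap.coe_mk, AddHom.coe_mk, h, scalarModule_smul_apply, mul_one]
    right_inv := fun G => ext fun b => by
      simp only [ofLin_apply, LinearMap.coe_mk, AddHom.coe_mk, one_smul]
    map_add' := fun F G => ext fun b => rfl }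

theorem flatten_apply :
    ∀ (F : HomExt L K (HomExt k L M)) (b : K), flatten F b = F b 1 := fun _ _ => rfl

theorem flatten_smul {S : Type*} [CommRing S] [Algebra k S] [Module S M] [IsScalarTower k S M] :
    ∀ (z : K ⊗[L] (L ⊗[k] S)) (F : HomExt L K (HomExt k L M)),
      flatten (z • F) =
        Algebra.TensorProduct.cancelBaseChange k L L K S z • flatten F := by
  intro z F
  induction z with
  | zero => rw [zero_smul (K ⊗[L] (L ⊗[k] S)) F, map_zero, map_zero, zero_smul]
  | add y z hy hz => rw [add_smul, _root_.map_add, _root_.map_add, hy, hz, add_smul]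
  | tmul a y =>
    induction y with
    | zero => rw [TensorProduct.tmul_zero, zero_smul (K ⊗[L] (L ⊗[k] S)) F, map_zero, map_zero, zero_smul]
    | add y z hy hz => rw [TensorProduct.tmul_add, add_smul, _root_.map_add, _root_.map_add, hy, hz, add_smul]
    | tmul l x =>
      refine ext fun b => ?_
      rw [Algebra.TensorProduct.cancelBaseChange_tmul, flatten_apply, tmul_smul_apply,
        tmul_smul_apply, tmul_smul_apply, flatten_apply]
      have h : F (l • a * b) = l • F (a * b) := by
        rw [smul_mul_assoc, ← toLin_apply, map_smul, toLin_apply]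
      rw [h, scalarModule_smul_apply]

end

end HomExt

namespace SocleFree

variable {p : ℕ} {ι k S K M : Type*} [Field k] [Field K] [Algebra k K] [AddCommGroup M]
  [Module k M] [CommRing S] [Algebra k S] [Module S M] [IsScalarTower k S M]
  {s : ι → S} {J : Finset ι}

theorem prod_one_tmul (J : Finset ι) (s : ι → S) (n : ℕ) :
    ∏ i ∈ J, (1 ⊗ₜ[k] s i : K ⊗[k] S) ^ n = 1 ⊗ₜ ∏ i ∈ J, s i ^ n := by
  change ∏ i ∈ J, (Algebra.TensorProduct.includeRight (R := k) (A := K) (s i)) ^ n =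
    Algebra.TensorProduct.includeRight (∏ i ∈ J, s i ^ n)
  simp only [map_prod, map_pow]

/-- A functional `π` on `K` with `π 1 = 1` turns `m` into the map `b ↦ π b • m`; evaluation at `1`
brings the solution back. -/
theorem of_homExt (h : SocleFree p (fun i => (1 ⊗ₜ[k] s i : K ⊗[k] S)) J (HomExt k K M)) :
    SocleFree p s J M := by
  intro m hm
  obtain ⟨π, hπ⟩ := HomExt.exists_apply_one (k := k) (K := K) (1 : k)
  let F : HomExt k K M := HomExt.ofLin (LinearMap.toSpanSingleton k M m ∘ₗ π.toLin)
  have hF : ∀ b, F b = π b • m := fun _ => rfl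
  obtain ⟨c, hc⟩ := h F (HomExt.ext fun b => by
    rw [prod_one_tmul, HomExt.one_tmul_smul_apply, hF, smul_comm, hm, smul_zero,
      HomExt.zero_apply])
  refine ⟨fun i => c i 1, ?_⟩
  have h1 : F 1 = m := by rw [hF, hπ, one_smul]
  rw [← h1, hc, HomExt.sum_apply]
  simp only [HomExt.one_tmul_smul_apply]

theorem homExt (h : SocleFree p s J M) :
    SocleFree p (fun i => (1 ⊗ₜ[k] s i : K ⊗[k] S)) J (HomExt k K M) := by
  intro F hF
  rw [prod_one_tmul] at hF
  let φ : (ι → M) →ₗ[k] M := ∑ i ∈ J, (Algebra.lsmul k k M (s i)) ∘ₗ LinearMap.proj i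
  have hφ : ∀ c, φ c = ∑ i ∈ J, s i • c i := fun c => by
    simp [φ, LinearMap.sum_apply]
  obtain ⟨G, hG⟩ := HomExt.exists_comp_eq φ F fun b => by
    obtain ⟨c, hc⟩ := h (F b) (by rw [← HomExt.one_tmul_smul_apply (K := K), hF, HomExt.zero_apply])
    exact ⟨c, by rw [hφ, hc]⟩
  refine ⟨fun i => HomExt.ofLin (LinearMap.proj i ∘ₗ G.toLin), HomExt.ext fun b => ?_⟩
  rw [← hG, hφ, HomExt.sum_apply]
  simp only [HomExt.one_tmul_smul_apply]
  rfl

end SocleFree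


-- Induction on the number of elements.

universe u v w x y

/-- Detection of `SocleFree` in rank `n` by linear combinations with coefficients in an
algebraically closed extension. -/
def LinearDetection (p n : ℕ) : Prop :=
  ∀ (k : Type u) [Field k] [CharP k p] (K : Type v) [Field K] [IsAlgClosed K] [Algebra k K]
    (_ : (n : Cardinal) ≤ Algebra.trdeg k K + 1) (S : Type w) [CommRing S] [Algebra k S]
    (M : Type x) [AddCommGroup M] [Module k M] [Module S M] [IsScalarTower k S M]
    (ι : Type y) (s : ι → S) (_ : ∀ i, s i ^ p = 0) (J : Finset ι) (_ : J.card = n)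
    (_ : ∀ a : ι → K, (∃ i ∈ J, a i ≠ 0) → ∀ F : HomExt k K M,
      (∑ i ∈ J, a i ⊗ₜ[k] s i : K ⊗[k] S) ^ (p - 1) • F = 0 →
        ∃ G, F = (∑ i ∈ J, a i ⊗ₜ[k] s i : K ⊗[k] S) • G),
    SocleFree p s J M

theorem linearDetection_zero {p : ℕ} : LinearDetection.{u, v, w, x, y} p 0 := by
  intro k _ _ K _ _ _ _ S _ _ M _ _ _ _ ι s _ J hJ _ m hm
  rw [Finset.card_eq_zero] at hJ
  subst hJ
  simpa using hm

theorem linearDetection_one {p : ℕ} : LinearDetection.{u, v, w, x, y} p 1 := by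
  intro k _ _ K _ _ _ _ S _ _ M _ _ _ _ ι s _ J hJ H
  obtain ⟨i, rfl⟩ := Finset.card_eq_one.1 hJ
  refine SocleFree.of_homExt (k := k) (K := K) (socleFree_singleton_iff.2 fun F hF => ?_)
  have := H (fun _ => 1) ⟨i, Finset.mem_singleton_self i, one_ne_zero⟩ F
  simp only [Finset.sum_singleton] at this
  exact this hF

section Step

variable {p : ℕ} {k : Type u} [Field k] {L K : Type v} [Field L] [Field K] [Algebra k L]
  [Algebra k K] [Algebra L K] [IsScalarTower k L K] {S : Type w} [CommRing S] [Algebra k S]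
  {M : Type x} [AddCommGroup M] [Module k M] [Module S M] [IsScalarTower k S M]
  {ι : Type y} [DecidableEq ι] {s : ι → S} {i j : ι} {J : Finset ι}

attribute [local instance] HomExt.scalarModule HomExt.isScalarTower_scalarModule

/-- The elements obtained by base change to `L` and replacing `s j` by `l s i + m s j`. -/
def pencil (k : Type u) [Field k] {L : Type v} [Field L] [Algebra k L] {S : Type w} [CommRing S]
    [Algebra k S] (s : ι → S) (i j : ι) (l m : L) : ι → L ⊗[k] S :=
  Function.update (fun c => 1 ⊗ₜ s c) j (l ⊗ₜ s i + m ⊗ₜ s j)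

theorem pencil_self (l m : L) : pencil k s i j l m j = l ⊗ₜ s i + m ⊗ₜ s j :=
  Function.update_self _ _ _

theorem pencil_of_ne (l m : L) {c : ι} (hc : c ≠ j) : pencil k s i j l m c = 1 ⊗ₜ s c :=
  Function.update_of_ne hc _ _

theorem pencil_pow [Fact p.Prime] [CharP k p] (hs : ∀ c, s c ^ p = 0) (l m : L) (c : ι) :
    pencil k s i j l m c ^ p = 0 := by
  have hp : p ≠ 0 := (Fact.out : p.Prime).ne_zero
  by_cases hc : c = j
  · subst hc
    rw [pencil_self]
    have := sum_pow_char_eq_zero (p := p) k Finset.univ ![(l ⊗ₜ s i : L ⊗[k] S), m ⊗ₜ s c] (by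
      intro b _
      fin_cases b <;> simp [Algebra.TensorProduct.tmul_pow, hs])
    simpa using this
  · rw [pencil_of_ne l m hc, Algebra.TensorProduct.tmul_pow, hs, TensorProduct.tmul_zero]

theorem pencil_hypothesis (hij : i ≠ j) (hi : i ∉ J) (hj : j ∉ J)
    (H : ∀ a : ι → K, (∃ c ∈ insert i (insert j J), a c ≠ 0) → ∀ F : HomExt k K M,
      (∑ c ∈ insert i (insert j J), a c ⊗ₜ[k] s c : K ⊗[k] S) ^ (p - 1) • F = 0 →
        ∃ G, F = (∑ c ∈ insert i (insert j J), a c ⊗ₜ[k] s c : K ⊗[k] S) • G)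
    {l m : L} (hlm : l ≠ 0 ∨ m ≠ 0) (b : ι → K) (hb : ∃ c ∈ insert j J, b c ≠ 0)
    (F : HomExt L K (HomExt k L M))
    (hF : (∑ c ∈ insert j J, b c ⊗ₜ[L] pencil k s i j l m c : K ⊗[L] (L ⊗[k] S)) ^ (p - 1) • F = 0) :
    ∃ G, F = (∑ c ∈ insert j J, b c ⊗ₜ[L] pencil k s i j l m c : K ⊗[L] (L ⊗[k] S)) • G := by
  -- The coefficients of the same linear form after expanding the element `l s i + m s j` at
  -- position `j`.
  let a : ι → K := Function.update (Function.update b j (m • b j)) i (l • b j)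
  have hai : a i = l • b j := Function.update_self _ _ _
  have haj : a j = m • b j := by
    simp only [a]; rw [Function.update_of_ne hij.symm, Function.update_self]
  have hac : ∀ c ∈ J, a c = b c := fun c hc => by
    simp only [a]
    rw [Function.update_of_ne (ne_of_mem_of_not_mem hc hi), Function.update_of_ne (ne_of_mem_of_not_mem hc hj)]
  have ha : ∃ c ∈ insert i (insert j J), a c ≠ 0 := by
    obtain ⟨c, hc, hbc⟩ := hb
    rcases Finset.mem_insert.1 hc with rfl | hc'
    · rcases hlm with h | h
      · exact ⟨i, by simp, by rw [hai]; exact smul_ne_zero h hbc⟩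
      · exact ⟨c, by simp, by rw [haj]; exact smul_ne_zero h hbc⟩
    · exact ⟨c, by simp [hc'], by rw [hac c hc']; exact hbc⟩
  let Θ := Algebra.TensorProduct.cancelBaseChange k L L K S
  have hΘ : Θ (∑ c ∈ insert j J, b c ⊗ₜ[L] pencil k s i j l m c) =
      ∑ c ∈ insert i (insert j J), a c ⊗ₜ[k] s c := by
    rw [map_sum, Finset.sum_insert hj, Finset.sum_insert (by simp [hij, hi]),
      Finset.sum_insert hj, pencil_self, TensorProduct.tmul_add, map_add, hai, haj]
    have hrest : ∑ c ∈ J, Θ (b c ⊗ₜ[L] pencil k s i j l m c) = ∑ c ∈ J, a c ⊗ₜ[k] s c :=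
      Finset.sum_congr rfl fun c hc => by
        rw [pencil_of_ne l m (ne_of_mem_of_not_mem hc hj), Algebra.TensorProduct.cancelBaseChange_tmul,
          one_smul, hac c hc]
    rw [hrest, Algebra.TensorProduct.cancelBaseChange_tmul,
      Algebra.TensorProduct.cancelBaseChange_tmul, add_assoc]
  have h1 := congrArg HomExt.flatten hF
  rw [HomExt.flatten_smul, map_pow, map_zero, hΘ] at h1
  obtain ⟨G, hG⟩ := H a ha _ h1
  refine ⟨HomExt.flatten.symm G, HomExt.flatten.injective ?_⟩
  rw [HomExt.flatten_smul, hΘ, AddEquiv.apply_symm_apply, hG]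

theorem socleFree_of_pencil [Fact p.Prime] [CharP k p] [IsAlgClosed L] {t : L}
    (ht : Transcendental k t) (hs : ∀ c, s c ^ p = 0) (hij : i ≠ j) (hi : i ∉ J) (hj : j ∉ J)
    (H : ∀ l m : L, (l ≠ 0 ∨ m ≠ 0) →
      SocleFree p (pencil k s i j l m) (insert j J) (HomExt k L M)) :
    SocleFree p s (insert i (insert j J)) M := by
  have hp : p ≠ 0 := (Fact.out : p.Prime).ne_zero
  -- Any one pencil gives the condition for the remaining elements; `(1, 0)` is used.
  have hJ : SocleFree p s J M := by
    refine SocleFree.of_homExt (k := k) (K := L) (SocleFree.congr (SocleFree.mono hp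
      (fun c _ => pencil_pow hs _ _ c) (H 1 0 (Or.inl one_ne_zero)) (Finset.subset_insert j J)) ?_)
    exact fun c hc => pencil_of_ne _ _ (ne_of_mem_of_not_mem hc hj)
  set T : S := ∏ c ∈ J, s c ^ (p - 1) with hT
  -- On `W = T M` every `s c` with `c ∈ J` acts as zero, so only `s i` and `s j` matter there.
  let W : Submodule S M := LinearMap.range (LinearMap.lsmul S M T)
  let φ : M →ₗ[S] W := (LinearMap.lsmul S M T).rangeRestrict
  have hφ : ∀ m, (φ m : M) = T • m := fun _ => rfl
  have hφs : Function.Surjective φ := LinearMap.surjective_rangeRestrict _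
  have hTs : ∀ c ∈ J, ∀ m, s c • φ m = 0 := fun c hc m => Subtype.ext <| by
    have := SocleFree.prod_smul_sum (M := M) (J := J) (s := s) hp (fun c _ => hs c)
      (Function.update 0 c m)
    rw [Submodule.coe_smul, hφ, smul_comm, Submodule.coe_zero, ← this]
    congr 1
    rw [Finset.sum_eq_single_of_mem c hc fun b _ hb => by simp [hb], Function.update_self]
  have hx : ∀ l m : L, (l ≠ 0 ∨ m ≠ 0) → ∀ F : HomExt k L W,
      (l ⊗ₜ[k] s i + m ⊗ₜ[k] s j : L ⊗[k] S) ^ (p - 1) • F = 0 →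
        ∃ G, F = (l ⊗ₜ[k] s i + m ⊗ₜ[k] s j : L ⊗[k] S) • G := by
    intro l m hlm F hF
    obtain ⟨F₁, hF₁⟩ := HomExt.exists_comp_eq (φ.restrictScalars k) F fun b => hφs _
    have hF₁' : HomExt.map L φ F₁ = F := HomExt.ext hF₁
    have hpe : ∀ c ∈ J, pencil k s i j l m c = 1 ⊗ₜ s c := fun c hc =>
      pencil_of_ne l m (ne_of_mem_of_not_mem hc hj)
    obtain ⟨c, hc⟩ := H l m hlm F₁ (by
      rw [Finset.prod_insert hj, pencil_self, Finset.prod_congr rfl fun c hc => by rw [hpe c hc],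
        SocleFree.prod_one_tmul, mul_comm, mul_smul]
      rw [← hF₁', ← map_smul] at hF
      refine HomExt.ext fun b => ?_
      rw [HomExt.one_tmul_smul_apply, ← hφ, ← HomExt.map_apply φ, hF]
      rfl)
    refine ⟨HomExt.map L φ (c j), ?_⟩
    rw [← hF₁', hc, Finset.sum_insert hj, pencil_self, map_add, map_smul, map_sum,
      Finset.sum_eq_zero, add_zero]
    intro d hd
    rw [hpe d hd, map_smul]
    exact HomExt.ext fun b => by
      rw [HomExt.one_tmul_smul_apply, HomExt.map_apply, hTs d hd, HomExt.zero_apply]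
  intro m hm
  rw [Finset.prod_insert (by simp [hij, hi]), Finset.prod_insert hj, ← mul_assoc, mul_smul] at hm
  obtain ⟨u, v, huv⟩ := exists_eq_smul_add_smul (p := p) ht (hs i) (hs j) hx (w := φ m) (by
    refine Subtype.ext ?_
    rw [Submodule.coe_smul, hφ, hT, hm, Submodule.coe_zero])
  obtain ⟨u, rfl⟩ := hφs u
  obtain ⟨v, rfl⟩ := hφs v
  -- From `T m = s i T u + s j T v` the difference is killed by `T`.
  obtain ⟨c, hc⟩ := hJ (m - s i • u - s j • v) (by
    have := congrArg Subtype.val huv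
    rw [Submodule.coe_add, Submodule.coe_smul, Submodule.coe_smul, hφ, hφ, hφ] at this
    rw [← hT, smul_sub, smul_sub, this, smul_comm T, smul_comm T]
    abel)
  refine ⟨Function.update (Function.update c j v) i u, ?_⟩
  rw [Finset.sum_insert (by simp [hij, hi]), Finset.sum_insert hj, Function.update_self,
    Function.update_of_ne hij.symm, Function.update_self,
    Finset.sum_congr rfl fun d hd => by
      rw [Function.update_of_ne (ne_of_mem_of_not_mem hd hi),
        Function.update_of_ne (ne_of_mem_of_not_mem hd hj)], ← hc]
  abel

theorem linearDetection_succ [Fact p.Prime] {n : ℕ}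
    (ih : LinearDetection.{v, v, max v w, max v x, y} p (n + 1)) :
    LinearDetection.{u, v, w, x, y} p (n + 2) := by
  classical
  intro k _ _ K _ _ _ htr S _ _ M _ _ _ _ ι s hs J' hJ' H
  obtain ⟨i, J'', hi, rfl, hJ''⟩ := Finset.card_eq_succ.1 hJ'
  obtain ⟨j, J, hj, rfl, hJ⟩ := Finset.card_eq_succ.1 hJ''
  rw [Finset.mem_insert, not_or] at hi
  obtain ⟨L, hL, ⟨t, ht⟩, htrL⟩ := exists_intermediate_isAlgClosed k K htr
  have : CharP L p := charP_of_injective_algebraMap (algebraMap k L).injective p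
  exact socleFree_of_pencil ht hs hi.1 hi.2 hj fun l m hlm =>
    ih L K htrL (L ⊗[k] S) (HomExt k L M) ι (pencil k s i j l m) (pencil_pow hs l m) _ hJ''
      (pencil_hypothesis hi.1 hi.2 hj H hlm)

end Step

theorem linearDetection (p : ℕ) [Fact p.Prime] (n : ℕ) : LinearDetection.{u, v, w, x, y} p n := by
  -- These universes are stable under replacing `k`, `S`, `M` by `L`, `L ⊗ S`, `M ^ L`, so the
  -- induction runs inside them; one further step reaches the general case.
  have aux : ∀ n, LinearDetection.{v, v, max v w, max v x, y} p (n + 1) := by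
    intro n
    induction n with
    | zero => exact linearDetection_one
    | succ n ih => exact linearDetection_succ.{v, v, max v w, max v x, y} ih
  match n with
  | 0 => exact linearDetection_zero
  | 1 => exact linearDetection_one
  | n + 2 => exact linearDetection_succ (aux n)


/-! ### Truncated algebras and the criterion for freeness. -/

/-- An algebra over a field generated by elements `s i` with `s i ^ p = 0`, with augmentation
ideal generated by the `s i` and with socle spanned by the nonzero element
`∏ i, s i ^ (p - 1)`. -/
structure IsTruncated (p : ℕ) (K : Type*) {S ι : Type*} [Field K] [CommRing S] [Algebra K S]
    [Fintype ι] (s : ι → S) : Prop where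
  pow_eq_zero : ∀ i, s i ^ p = 0
  exists_sub_mem : ∀ z, ∃ c : K, z - algebraMap K S c ∈ Ideal.span (Set.range s)
  prod_ne_zero : ∏ i, s i ^ (p - 1) ≠ 0
  exists_eq_smul_prod : ∀ z, (∀ i, s i * z = 0) → ∃ c : K, z = c • ∏ i, s i ^ (p - 1)

namespace IsTruncated

variable {p : ℕ} {K S ι : Type*} [Field K] [CommRing S] [Algebra K S] [Fintype ι] {s : ι → S}

theorem mem_span_iff {z : S} : z ∈ Ideal.span (Set.range s) ↔ ∃ c : ι → S, z = ∑ i, s i • c i := by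
  rw [Ideal.mem_span_range_iff_exists_fun]
  simp only [smul_eq_mul, mul_comm, eq_comm]

theorem socleFree_self (hp : p ≠ 0) (h : IsTruncated p K s) : SocleFree p s Finset.univ S := by
  intro z hz
  obtain ⟨c, hc⟩ := h.exists_sub_mem z
  obtain ⟨d, hd⟩ := mem_span_iff.1 hc
  have h1 := SocleFree.prod_smul_sum (J := Finset.univ) hp (fun i _ => h.pow_eq_zero i) d
  rw [← hd, smul_sub, hz, zero_sub, neg_eq_zero, smul_eq_mul, mul_comm, ← Algebra.smul_def,
    smul_eq_zero] at h1
  have h2 := h1.resolve_right h.prod_ne_zero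
  rw [h2, map_zero, sub_zero] at hd
  exact ⟨d, hd⟩

theorem isNilpotent_span (h : IsTruncated p K s) :
    IsNilpotent (Ideal.span (Set.range s)) := by
  classical
  refine (Ideal.FG.isNilpotent_iff_le_nilradical ⟨Finset.univ.image s, by simp⟩).2 ?_
  rw [Ideal.span_le]
  rintro _ ⟨i, rfl⟩
  exact ⟨p, h.pow_eq_zero i⟩

variable {M : Type*} [AddCommGroup M] [Module S M]

/-- For each `s i` in turn, multiply by its last power that does not kill the element. -/
theorem exists_ne_zero_killed (h : IsTruncated p K s) (N : Submodule S M)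
    (hN : N ≠ ⊥) : ∃ z ∈ N, z ≠ 0 ∧ ∀ i, s i • z = 0 := by
  classical
  have key : ∀ J : Finset ι, ∃ z ∈ N, z ≠ 0 ∧ ∀ i ∈ J, s i • z = 0 := by
    intro J
    induction J using Finset.induction_on with
    | empty =>
      obtain ⟨z, hz, h0⟩ := N.ne_bot_iff.1 hN
      exact ⟨z, hz, h0, by simp⟩
    | insert i J _ ih =>
      obtain ⟨z, hz, h0, hJ⟩ := ih
      have hex : ∃ n, s i ^ n • z = 0 := ⟨p, by rw [h.pow_eq_zero, zero_smul]⟩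
      have hn0 : Nat.find hex ≠ 0 := fun hn => h0 <| by
        have := Nat.find_spec hex
        rwa [hn, pow_zero, one_smul] at this
      refine ⟨s i ^ (Nat.find hex - 1) • z, N.smul_mem _ hz,
        Nat.find_min hex (Nat.sub_one_lt hn0), fun c hc => ?_⟩
      rcases Finset.mem_insert.1 hc with rfl | hc
      · rw [smul_smul, ← pow_succ', Nat.sub_one_add_one hn0]
        exact Nat.find_spec hex
      · rw [smul_comm, hJ c hc, smul_zero]
  obtain ⟨z, hz, h0, h1⟩ := key Finset.univ
  exact ⟨z, hz, h0, fun i => h1 i (Finset.mem_univ i)⟩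

/-- The criterion for freeness. -/
theorem free_of_socleFree (h : IsTruncated p K s)
    (hM : SocleFree p s Finset.univ M) : Module.Free S M := by
  let _ : Module K M := Module.compHom M (algebraMap K S)
  have : IsScalarTower K S M := ⟨fun a x m => by
    rw [Algebra.smul_def, mul_smul]; rfl⟩
  set I := Ideal.span (Set.range s) with hI
  let P : Submodule S M := I • ⊤
  have hP : ∀ m, m ∈ P ↔ ∃ c : ι → M, m = ∑ i, s i • c i := by
    intro m
    constructor
    · intro hm
      induction hm using Submodule.smul_induction_on' with
      | smul r hr n hn =>
        obtain ⟨c, rfl⟩ := mem_span_iff.1 hr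
        exact ⟨fun i => c i • n, by simp only [Finset.sum_smul, smul_assoc]⟩
      | add x hx y hy hx' hy' =>
        obtain ⟨c, rfl⟩ := hx'
        obtain ⟨d, rfl⟩ := hy'
        exact ⟨c + d, by simp only [Pi.add_apply, smul_add, Finset.sum_add_distrib]⟩
    · rintro ⟨c, rfl⟩
      exact Submodule.sum_mem _ fun i _ => Submodule.smul_mem_smul
        (Ideal.subset_span (Set.mem_range_self i)) trivial
  let P' : Submodule K M := P.restrictScalars K
  let b := Module.Basis.ofVectorSpace K (M ⧸ P')
  choose e he using fun i => Submodule.mkQ_surjective P' (b i)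
  -- A nonzero relation module contains a relation killed by all `s i`, hence with coefficients `c
  -- i` times the socle element. The hypothesis puts `∑ c i • e i` in `I M`, so the `c i` vanish.
  have hli : LinearIndependent S e := by
    rw [linearIndependent_iff_ker]
    by_contra hker
    obtain ⟨z, hz, h0, hsz⟩ := exists_ne_zero_killed h _ hker
    have hcoord : ∀ i, ∃ c : K, z i = c • ∏ i, s i ^ (p - 1) := fun i =>
      h.exists_eq_smul_prod _ fun j => by
        rw [← smul_eq_mul, ← Finsupp.smul_apply, hsz, Finsupp.zero_apply]
    choose c hc using hcoord
    have h1 : (∏ i, s i ^ (p - 1)) • ∑ i ∈ z.support, c i • e i = 0 := by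
      rw [LinearMap.mem_ker, Finsupp.linearCombination_apply, Finsupp.sum] at hz
      rw [← hz, Finset.smul_sum]
      refine Finset.sum_congr rfl fun i _ => ?_
      rw [hc i, smul_assoc, smul_comm]
    have h2 : ∑ i ∈ z.support, c i • e i ∈ P' := (hP _).2 (hM _ h1)
    have h3 : ∑ i ∈ z.support, c i • b i = 0 := by
      have := (Submodule.Quotient.mk_eq_zero P').2 h2
      rw [← Submodule.mkQ_apply, map_sum] at this
      simpa only [map_smul, he] using this
    have h4 := linearIndependent_iff'.1 b.linearIndependent _ _ h3
    exact h0 <| Finsupp.ext fun i => by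
      by_cases hi : i ∈ z.support
      · rw [hc i, h4 i hi, zero_smul, Finsupp.zero_apply]
      · exact Finsupp.notMem_support_iff.1 hi
  -- Nakayama for the nilpotent ideal `I`, valid without finiteness of `M`.
  have hspan : ⊤ ≤ Submodule.span S (Set.range e) := by
    obtain ⟨n, hn⟩ := isNilpotent_span h
    have hstep : (⊤ : Submodule S M) ≤ Submodule.span S (Set.range e) ⊔ I • ⊤ := by
      intro m _
      have hm := b.linearCombination_repr (P'.mkQ m)
      rw [Finsupp.linearCombination_apply, Finsupp.sum] at hm
      let m' := ∑ i ∈ (b.repr (P'.mkQ m)).support, b.repr (P'.mkQ m) i • e i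
      have hm' : m - m' ∈ P' := by
        rw [← Submodule.Quotient.mk_eq_zero, ← Submodule.mkQ_apply, map_sub, sub_eq_zero, ← hm]
        simp only [m', map_sum, map_smul, he]
      rw [← add_sub_cancel m' m]
      refine Submodule.add_mem_sup (Submodule.sum_mem _ fun i _ => ?_) hm'
      rw [← algebraMap_smul S]
      exact Submodule.smul_mem _ _ (Submodule.subset_span (Set.mem_range_self i))
    have hpow : ∀ n : ℕ, (⊤ : Submodule S M) ≤ Submodule.span S (Set.range e) ⊔ I ^ n • ⊤ := by
      intro n
      induction n with
      | zero => simp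
      | succ n ih =>
        refine ih.trans (sup_le le_sup_left ?_)
        refine (Submodule.smul_mono (le_refl (I ^ n)) hstep).trans ?_
        rw [Submodule.smul_sup, pow_succ, Submodule.mul_smul]
        exact sup_le_sup Submodule.smul_le_right le_rfl
    have := hpow n
    rwa [hn, Submodule.zero_eq_bot, Submodule.bot_smul, sup_bot_eq] at this
  exact Module.Free.of_basis (Module.Basis.mk hli hspan)

theorem projective_iff (hp : p ≠ 0) (h : IsTruncated p K s) :
    Module.Projective S M ↔ SocleFree p s Finset.univ M :=
  ⟨fun _ => (h.socleFree_self hp).of_projective, fun hM =>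
    have := h.free_of_socleFree hM
    inferInstance⟩

end IsTruncated


/-! ### Truncated polynomial algebras and their base change. -/

namespace TruncPoly

open MvPolynomial

variable {k : Type*} [Field k] {p r : ℕ}

/-- The class of the variable `t_i`. -/
noncomputable def var (k : Type*) [Field k] (p r : ℕ) (i : Fin r) : TruncPoly k p r :=
  Ideal.Quotient.mk _ (X i)

theorem mem_ideal_iff {f : MvPolynomial (Fin r) k} :
    f ∈ Ideal.span (Set.range fun i : Fin r => (X i : MvPolynomial (Fin r) k) ^ p) ↔
      ∀ e ∈ f.support, ∃ i, p ≤ e i := by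
  have : (Set.range fun i : Fin r => (X i : MvPolynomial (Fin r) k) ^ p) =
      (fun s => monomial s (1 : k)) '' Set.range fun i : Fin r => Finsupp.single i p := by
    rw [← Set.range_comp]
    exact congrArg Set.range (funext fun i => by simp [X_pow_eq_monomial])
  rw [this, mem_ideal_span_monomial_image]
  simp only [Set.exists_range_iff, Finsupp.single_le_iff]

theorem prod_var : ∏ i, var k p r i ^ (p - 1) =
    Ideal.Quotient.mk _ (monomial (Finsupp.equivFunOnFinite.symm fun _ => p - 1) (1 : k)) := by
  simp only [var, ← map_pow, ← map_prod]
  congr 1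
  rw [monomial_eq, Finsupp.prod_fintype _ _ fun i => pow_zero _]
  simp

theorem isTruncated (hp : p ≠ 0) : IsTruncated p k (var k p r) where
  pow_eq_zero i := by
    rw [var, ← map_pow, Ideal.Quotient.eq_zero_iff_mem]
    exact Ideal.subset_span ⟨i, rfl⟩
  exists_sub_mem z := by
    obtain ⟨f, rfl⟩ := Ideal.Quotient.mk_surjective z
    refine ⟨constantCoeff f, ?_⟩
    induction f using MvPolynomial.induction_on with
    | C a =>
      rw [constantCoeff_C, ← Ideal.Quotient.mk_algebraMap, algebraMap_eq, sub_self]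
      exact zero_mem _
    | add f g hf hg =>
      rw [map_add, map_add, map_add, add_sub_add_comm]
      exact add_mem hf hg
    | mul_X f i _ =>
      rw [map_mul constantCoeff, constantCoeff_X, mul_zero, map_zero, sub_zero, map_mul]
      exact Ideal.mul_mem_left _ _ (Ideal.subset_span ⟨i, rfl⟩)
  prod_ne_zero := by
    rw [prod_var, Ne, Ideal.Quotient.eq_zero_iff_mem, mem_ideal_iff]
    intro h
    obtain ⟨i, hi⟩ := h (Finsupp.equivFunOnFinite.symm fun _ => p - 1) (by simp)
    rw [Finsupp.coe_equivFunOnFinite_symm] at hi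
    omega
  exists_eq_smul_prod z hz := by
    obtain ⟨f, rfl⟩ := Ideal.Quotient.mk_surjective z
    set N : Fin r →₀ ℕ := Finsupp.equivFunOnFinite.symm fun _ => p - 1 with hN
    refine ⟨f.coeff N, ?_⟩
    rw [prod_var, ← Ideal.Quotient.mkₐ_eq_mk k, ← map_smul, Ideal.Quotient.mkₐ_eq_mk,
      Ideal.Quotient.eq, mem_ideal_iff]
    intro e he
    by_contra! hcon
    rw [mem_support_iff, coeff_sub, coeff_smul, coeff_monomial] at he
    have heN : N ≠ e := by
      rintro rfl
      simp [← hN] at he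
    rw [if_neg heN, smul_zero, sub_zero] at he
    refine heN (Finsupp.ext fun i => ?_)
    -- All exponents of `e` are below `p`, while `t_i f = 0` forces some exponent of `t_i` times
    -- this monomial to reach `p`; so `e i = p - 1`.
    have hi := hz i
    rw [var, ← map_mul, Ideal.Quotient.eq_zero_iff_mem, mem_ideal_iff] at hi
    obtain ⟨j, hj⟩ := hi (Finsupp.single i 1 + e) (by rwa [mem_support_iff, coeff_X_mul])
    have hj' := hcon j
    rw [Finsupp.add_apply, Finsupp.single_apply] at hj
    split_ifs at hj with hij
    · subst hij
      simp only [hN, Finsupp.coe_equivFunOnFinite_symm]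
      omega
    · omega

end TruncPoly

namespace TruncPolyOne

open Polynomial

variable {K : Type*} [Field K] {p : ℕ}

/-- The class of the variable `t`. -/
noncomputable def var (K : Type*) [Field K] (p : ℕ) : TruncPolyOne K p := Ideal.Quotient.mk _ X

theorem isTruncated (hp : p ≠ 0) : IsTruncated p K fun _ : Unit => var K p where
  pow_eq_zero _ := by
    rw [var, ← map_pow, Ideal.Quotient.eq_zero_iff_mem]
    exact Ideal.mem_span_singleton_self _
  exists_sub_mem z := by
    obtain ⟨f, rfl⟩ := Ideal.Quotient.mk_surjective z
    refine ⟨f.coeff 0, ?_⟩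
    have hf := congrArg (Ideal.Quotient.mk (Ideal.span {(X : K[X]) ^ p})) (divX_mul_X_add f)
    rw [← hf, map_add, ← Ideal.Quotient.mk_algebraMap, algebraMap_eq, add_sub_cancel_right, map_mul]
    exact Ideal.mul_mem_left _ _ (Ideal.subset_span ⟨(), rfl⟩)
  prod_ne_zero := by
    rw [Fintype.prod_unique, var, ← map_pow, Ne, Ideal.Quotient.eq_zero_iff_mem,
      Ideal.mem_span_singleton, X_pow_dvd_iff]
    intro h
    have := h (p - 1) (Nat.sub_one_lt hp)
    simp at this
  exists_eq_smul_prod z hz := by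
    obtain ⟨f, rfl⟩ := Ideal.Quotient.mk_surjective z
    have h := hz ()
    rw [var, ← map_mul, Ideal.Quotient.eq_zero_iff_mem, Ideal.mem_span_singleton] at h
    obtain ⟨g, hg⟩ : X ^ (p - 1) ∣ f := by
      obtain ⟨g, hg⟩ := h
      refine ⟨g, mul_left_cancel₀ X_ne_zero (hg.trans ?_)⟩
      rw [← mul_assoc, ← pow_succ', Nat.sub_one_add_one hp]
    refine ⟨g.coeff 0, ?_⟩
    rw [Fintype.prod_unique, var, ← map_pow, ← Ideal.Quotient.mkₐ_eq_mk K, ← map_smul,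
      Ideal.Quotient.mkₐ_eq_mk, Ideal.Quotient.eq, Ideal.mem_span_singleton, hg]
    refine ⟨g.divX, ?_⟩
    have hX : (X : K[X]) ^ p = X ^ (p - 1) * X := by rw [← pow_succ, Nat.sub_one_add_one hp]
    rw [smul_eq_C_mul, hX]
    linear_combination -(X ^ (p - 1)) * divX_mul_X_add g

end TruncPolyOne

theorem IsTruncated.baseChange {p : ℕ} {k K S ι : Type*} [Field k] [Field K] [Algebra k K]
    [CommRing S] [Algebra k S] [Fintype ι] {s : ι → S} (h : IsTruncated p k s) :
    IsTruncated p K fun i => (1 ⊗ₜ[k] s i : K ⊗[k] S) where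
  pow_eq_zero i := by
    rw [Algebra.TensorProduct.tmul_pow, h.pow_eq_zero, TensorProduct.tmul_zero]
  exists_sub_mem z := by
    induction z with
    | zero => exact ⟨0, by simp⟩
    | add y z hy hz =>
      obtain ⟨c, hc⟩ := hy
      obtain ⟨d, hd⟩ := hz
      exact ⟨c + d, by rw [map_add, add_sub_add_comm]; exact add_mem hc hd⟩
    | tmul a x =>
      obtain ⟨c, hc⟩ := h.exists_sub_mem x
      obtain ⟨d, hd⟩ := IsTruncated.mem_span_iff.1 hc
      refine ⟨c • a, IsTruncated.mem_span_iff.2 ⟨fun i => a ⊗ₜ d i, ?_⟩⟩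
      rw [Algebra.TensorProduct.algebraMap_apply, Algebra.algebraMap_self_apply,
        TensorProduct.smul_tmul, ← Algebra.algebraMap_eq_smul_one, ← TensorProduct.tmul_sub, hd,
        TensorProduct.tmul_sum]
      simp only [smul_eq_mul, Algebra.TensorProduct.tmul_mul_tmul, one_mul]
  prod_ne_zero := by
    rw [SocleFree.prod_one_tmul]
    intro h0
    refine h.prod_ne_zero (Algebra.TensorProduct.includeRight_injective (R := k) (A := K)
      (algebraMap k K).injective ?_)
    rw [map_zero]
    exact h0
  exists_eq_smul_prod z hz := by
    -- Coordinates along a `k`-basis of `K` are again killed by every `s i`, so the socle over `k`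
    -- determines them.
    let b := Module.Basis.ofVectorSpace k K
    obtain ⟨c, rfl⟩ := TensorProduct.eq_repr_basis_left b z
    have hc : ∀ j, ∃ d : k, c j = d • ∏ i, s i ^ (p - 1) := fun j => by
      refine h.exists_eq_smul_prod _ fun i => ?_
      let c' := c.mapRange (fun x => s i * x) (mul_zero _)
      have hc' : (c'.sum fun j x => b j ⊗ₜ[k] x) = 0 := by
        rw [← hz i, Finsupp.sum_mapRange_index fun j => TensorProduct.tmul_zero _ _, Finsupp.mul_sum]
        simp only [Algebra.TensorProduct.tmul_mul_tmul, one_mul]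
      have := DFunLike.congr_fun (TensorProduct.sum_tmul_basis_left_eq_zero b c' hc') j
      simpa [c'] using this
    choose d hd using hc
    refine ⟨∑ j ∈ c.support, d j • b j, ?_⟩
    rw [SocleFree.prod_one_tmul, TensorProduct.smul_tmul', smul_eq_mul, mul_one,
      TensorProduct.sum_tmul, Finsupp.sum]
    exact Finset.sum_congr rfl fun j _ => by rw [hd j, TensorProduct.smul_tmul]

/-- A linear form with `a j ≠ 0` may replace `s j` in the family; restriction to that single element
gives the flatness of the corresponding `α`. -/
theorem IsTruncated.socleFree_linear {p : ℕ} {K S ι : Type*} [Field K] [CommRing S] [Algebra K S]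
    [Fintype ι] {s : ι → S} (hp : p ≠ 0) (h : IsTruncated p K s) {a : ι → K} {j : ι}
    (haj : a j ≠ 0) {x : S} (hx : x = ∑ i, algebraMap K S (a i) * s i) (hxp : x ^ p = 0) :
    SocleFree p (fun _ : Unit => x) {()} S := by
  classical
  have h1 := (h.socleFree_self hp).change hp (fun i _ => h.pow_eq_zero i) (Finset.mem_univ j)
    (fun i => algebraMap K S (a i)) ((IsUnit.mk0 _ haj).map _)
  rw [← hx] at h1
  have h3 := h1.mono hp (fun i _ => by
    by_cases hij : i = j
    · subst hij; rwa [Function.update_self]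
    · rw [Function.update_of_ne hij]; exact h.pow_eq_zero i)
    (Finset.subset_univ {j})
  rw [socleFree_singleton_iff, Function.update_self] at h3
  exact socleFree_singleton_iff.2 h3

/-! ### Flatness and projectivity along one element, and the theorem. -/

section RankOne

variable {p : ℕ} {K A B : Type*} [Field K] [CommRing A] [CommRing B] [Algebra K A] {t : A}

theorem projectiveAlong_iff (hp : p ≠ 0) (hA : IsTruncated p K fun _ : Unit => t) (α : A →+* B)
    {N : Type*} [AddCommGroup N] [Module B N] :
    ProjectiveAlong α N ↔ SocleFree p (fun _ : Unit => α t) {()} N := by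
  let _ : Module A N := Module.compHom N α
  have huniv : (Finset.univ : Finset Unit) = {()} := rfl
  have hsmul : ∀ (z : A) (n : N), z • n = α z • n := fun _ _ => rfl
  change Module.Projective A N ↔ _
  rw [hA.projective_iff hp, huniv, socleFree_singleton_iff, socleFree_singleton_iff]
  simp only [hsmul, map_pow]

/-- By the equational criterion, a relation `t ^ (p - 1) z = 0` in a flat `B` comes from relations
in `A`, where the annihilator of `t ^ (p - 1)` is `t A`. Conversely the condition gives
projectivity, hence flatness. -/
theorem flat_iff_socleFree (hp : p ≠ 0) (hA : IsTruncated p K fun _ : Unit => t) (α : A →+* B) :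
    α.Flat ↔ SocleFree p (fun _ : Unit => α t) {()} B := by
  have huniv : (Finset.univ : Finset Unit) = {()} := rfl
  let _ : Algebra A B := α.toAlgebra
  have hsmul : ∀ (x : A) (y : B), x • y = α x * y := fun _ _ => rfl
  constructor
  · intro hα
    have hflat : Module.Flat A B := hα
    refine socleFree_singleton_iff.2 fun z hz => ?_
    obtain ⟨n, a, y, hy, ha⟩ := Module.Flat.isTrivialRelation_of_sum_smul_eq_zero
      (R := A) (f := fun _ : Unit => t ^ (p - 1)) (x := fun _ => z)
      (by rw [Fintype.sum_unique, hsmul, map_pow]; exact hz)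
    have ha' : ∀ j, ∃ d, a () j = t * d := fun j => by
      have h1 := hA.socleFree_self hp
      rw [huniv, socleFree_singleton_iff] at h1
      exact h1 _ (by simpa using ha j)
    choose d hd using ha'
    refine ⟨∑ j, d j • y j, ?_⟩
    refine (hy ()).trans ?_
    rw [Finset.smul_sum]
    refine Finset.sum_congr rfl fun j _ => ?_
    rw [hd, hsmul, hsmul, smul_eq_mul, map_mul, mul_assoc]
  · intro h
    have : Module.Projective A B := by
      rw [hA.projective_iff hp, huniv, socleFree_singleton_iff]
      rw [socleFree_singleton_iff] at h
      intro z hz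
      rw [hsmul, map_pow] at hz
      exact h z hz
    exact (inferInstance : Module.Flat A B)

theorem TruncPolyOne.exists_algHom {p : ℕ} {K B : Type*} [Field K] [CommRing B] [Algebra K B]
    {x : B} (hx : x ^ p = 0) : ∃ α : TruncPolyOne K p →ₐ[K] B, α (TruncPolyOne.var K p) = x :=
  ⟨Ideal.Quotient.liftₐ _ (Polynomial.aeval x) fun f hf => by
    obtain ⟨g, rfl⟩ := Ideal.mem_span_singleton.1 hf
    rw [map_mul, map_pow, Polynomial.aeval_X, hx, zero_mul], Polynomial.aeval_X x⟩

end RankOne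

theorem mainTheorem6 (p : ℕ) [Fact p.Prime] (r : ℕ)
    (k : Type*) [Field k] [CharP k p]
    (K : Type*) [Field K] [Algebra k K] [IsAlgClosed K]
    (htr : (r : Cardinal) ≤ Algebra.trdeg k K + 1)
    (M : Type*) [AddCommGroup M] [Module k M] [Module (TruncPoly k p r) M]
    [IsScalarTower k (TruncPoly k p r) M] :
    Module.Projective (TruncPoly k p r) M ↔
      ∀ α : TruncPolyOne K p →ₐ[K] K ⊗[k] TruncPoly k p r,
        RingHom.Flat (R := TruncPolyOne K p) (S := K ⊗[k] TruncPoly k p r) α.toRingHom →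
          ProjectiveAlong α.toRingHom (HomExt k K M) := by
  have hp : p ≠ 0 := (Fact.out : p.Prime).ne_zero
  have : CharP K p := charP_of_injective_algebraMap (algebraMap k K).injective p
  have hR : IsTruncated p k (TruncPoly.var k p r) := TruncPoly.isTruncated hp
  have hRK : IsTruncated p K fun i => (1 ⊗ₜ[k] TruncPoly.var k p r i : K ⊗[k] TruncPoly k p r) :=
    hR.baseChange
  have hA : IsTruncated p K fun _ : Unit => TruncPolyOne.var K p := TruncPolyOne.isTruncated hp
  rw [hR.projective_iff hp]
  constructor
  · intro hM α hα
    have hproj : Module.Projective (K ⊗[k] TruncPoly k p r) (HomExt k K M) :=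
      (hRK.projective_iff hp).2 hM.homExt
    exact (projectiveAlong_iff (B := K ⊗[k] TruncPoly k p r) (N := HomExt k K M) hp hA α.toRingHom).2
      ((flat_iff_socleFree (B := K ⊗[k] TruncPoly k p r) hp hA α.toRingHom).1 hα).of_projective
  · intro H
    refine linearDetection p r k K htr (TruncPoly k p r) M (Fin r) (TruncPoly.var k p r)
      hR.pow_eq_zero Finset.univ (by simp) fun a ha => ?_
    set x : K ⊗[k] TruncPoly k p r := ∑ i, a i ⊗ₜ[k] TruncPoly.var k p r i with hx
    have hxp : x ^ p = 0 := by
      rw [hx]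
      refine sum_pow_char_eq_zero K Finset.univ
        (fun i => (a i ⊗ₜ[k] TruncPoly.var k p r i : K ⊗[k] TruncPoly k p r)) fun i _ => ?_
      rw [Algebra.TensorProduct.tmul_pow, hR.pow_eq_zero, TensorProduct.tmul_zero]
    obtain ⟨α, hα⟩ := TruncPolyOne.exists_algHom (K := K) (B := K ⊗[k] TruncPoly k p r) hxp
    have hαx : α.toRingHom (TruncPolyOne.var K p) = x := hα
    have hself : SocleFree p (fun _ : Unit => x) {()} (K ⊗[k] TruncPoly k p r) := by
      obtain ⟨j, -, haj⟩ := ha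
      refine hRK.socleFree_linear (S := K ⊗[k] TruncPoly k p r) hp haj ?_ hxp
      rw [hx]
      exact Finset.sum_congr rfl fun i _ => by
        rw [Algebra.TensorProduct.algebraMap_apply, Algebra.algebraMap_self_apply,
          Algebra.TensorProduct.tmul_mul_tmul, mul_one, one_mul]
    have hflat := (flat_iff_socleFree (B := K ⊗[k] TruncPoly k p r) hp hA α.toRingHom).2 (by rwa [hαx])
    have hproj := (projectiveAlong_iff (B := K ⊗[k] TruncPoly k p r) (N := HomExt k K M) hp hA α.toRingHom).1 (H α hflat)
    rwa [hαx, socleFree_singleton_iff] at hproj
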